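/- Let $(M,g)$ be a smooth oriented four-dimensional Lorentzian manifold of signature $(-,+,+,+)$ with smooth Killing fields $t^\mu$ and $\phi^\mu$. Suppose that on an asymptotic region of $M$ there are positively oriented coordinates $(t,r,\theta,\phi)$, with $t\in\mathbb{R}$, $r>R_0>0$ and $(\theta,\phi)$ the standard angles on $S^2$, in which $t^\mu\partial_\mu=\partial_t$ and $\phi^\mu\partial_\mu=\partial_\phi$, and such that $(t,x,y,z)$ with $(x,y,z)=r(\sin\theta\cos\phi,\sin\theta\sin\phi,\cos\theta)$ is a smooth chart of $M$ onto $\{(t,x,y,z): |(x,y,z)|>R_0\}$. Let $\Omega_{\mathcal H}\in\mathbb{R}$ and $X^\mu=t^\mu+\Omega_{\mathcal H}\phi^\mu$, and let $\mathcal H\subset M$ be a smooth null hypersurface generated by $X$ (that is, $X$ is tangent to the null generators of $\mathcal H$; it may vanish at a bifurcation sphere), for example an event horizon with angular velocity $\Omega_{\mathcal H}$. Let $\epsilon\in\mathbb{R}$, let $J^\mu$ be a $C^1$ vector field and $\mathcal S$ a real-valued function on $M$ with $$\nabla_\mu J^\mu+\epsilon\,\mathcal S=0,$$ and assume that $\mathcal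 L_tJ=\mathcal L_\phi J=0$ and $t^\mu J_\mu=\phi^\mu J_\mu=0$. Let $\Sigma$ be a smooth embedded hypersurface with boundary that runs from $\mathcal H$ to spatial infinity (for example a partial Cauchy surface): $\Sigma$ is diffeomorphic to $[1,\infty)\times S^2$, its boundary sphere lies in $\mathcal H$, and outside a compact set $\Sigma$ is a graph $t=h(r,\theta,\phi)$ over $\{r>R_1\}$ in the above coordinates. Let $d\Sigma_\mu=\varepsilon_{\mu\alpha\beta\gamma}\,e_1^\alpha e_2^\beta e_3^\gamma\,d^3y$ be its surface element, where $e_i=\partial/\partial y^i$ are the coordinate vectors of a parametrization of $\Sigma$, oriented like $(x,y,z)$ at large $r$ (so that $d\Sigma_\mu=\partial_\mu t\,\sqrt{-g}\,d^3x$ on a slice $t=\mathrm{const}$). If the integral $\int_\Sigma\mathcal S\,X^\mu d\Sigma_\mu$ converges absolutely, then the following limit exists and $$-\lim_{r\to\infty}\int J^r\sqrt{-g}\,d\theta\,d\phi=\epsilon\int_\Sigma \mathcal S\,X^\mu\,d\Sigma_\mu ,$$ where $J^r=J^\mu\partial_\mu r$ and $\sqrt{-g}$ refer to the coordinates $(t,r,\theta,\phi)$,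 and the integral on the left is over the sphere of radius $r$ at any fixed value $t=t_0$. -/

import Mathlib

open scoped ContDiff Manifold
open Filter Topology MeasureTheory

noncomputable section

namespace KillingFlux

/-- The model space of spacetime, with coordinates `x 0, x 1, x 2, x 3`. -/
abbrev E4 := EuclideanSpace ℝ (Fin 4)

/-- Euclidean three-space. -/
abbrev E3 := EuclideanSpace ℝ (Fin 3)

/-- The `μ`-th standard basis vector of `ℝ⁴`. -/
def basisVec (μ : Fin 4) : E4 := EuclideanSpace.single μ 1

/-- The `i`-th standard basis vector of `ℝ³`. -/
def basisVec3 (i : Fin 3) : E3 := EuclideanSpace.single i 1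

/-- The partial derivative `∂_μ f` of a function on `ℝ⁴`. -/
def partialDeriv (μ : Fin 4) (f : E4 → ℝ) (x : E4) : ℝ := fderiv ℝ f x (basisVec μ)

/-- The last three coordinates of a point of `ℝ⁴`. -/
def spatial (x : E4) : E3 := !₂[x 1, x 2, x 3]

section Manifold

variable {M : Type*} [TopologicalSpace M] [ChartedSpace E4 M]

variable (M) in
/-- A (not necessarily continuous) vector field on `M`. -/
abbrev Field := ∀ p : M, TangentSpace 𝓘(ℝ, E4) p

/-- The vector field `V` is of class `C^n`. -/
def IsSmoothField [IsManifold 𝓘(ℝ, E4) ∞ M] (n : WithTop ℕ∞) (V : Field M) : Prop :=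
  ContMDiff 𝓘(ℝ, E4) 𝓘(ℝ, E4).tangent n
    (fun p => (⟨p, V p⟩ : TangentBundle 𝓘(ℝ, E4) M))

/-- The coordinate vectors `∂_μ` of the chart `e`, at the point with coordinates `x`. -/
def coordFrame (e : OpenPartialHomeomorph M E4) (x : E4) (μ : Fin 4) :
    TangentSpace 𝓘(ℝ, E4) (e.symm x) :=
  mfderiv 𝓘(ℝ, E4) 𝓘(ℝ, E4) e.symm x (basisVec μ)

/-- The components `(V^μ)` of a vector field in the chart `e`, as functions of the coordinates. -/
def fieldComp (e : OpenPartialHomeomorph M E4) (V : Field M) (x : E4) : E4 :=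
  mfderiv 𝓘(ℝ, E4) 𝓘(ℝ, E4) e (e.symm x) (V (e.symm x))

variable (M) in
/-- A smooth Lorentzian metric of signature `(-,+,+,+)` on the four-manifold `M`. -/
structure LorentzianMetric where
  /-- the bilinear form on each tangent space -/
  toFun (p : M) :
    TangentSpace 𝓘(ℝ, E4) p →ₗ[ℝ] TangentSpace 𝓘(ℝ, E4) p →ₗ[ℝ] ℝ
  symm (p : M) (v w : TangentSpace 𝓘(ℝ, E4) p) : toFun p v w = toFun p w v
  signature (p : M) : ∃ b : Module.Basis (Fin 4) ℝ (TangentSpace 𝓘(ℝ, E4) p),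
    ∀ i j, toFun p (b i) (b j) = if i = j then (if i = 0 then -1 else 1) else 0
  /-- the components `g_{μν}` are smooth in every smooth chart -/
  smooth : ∀ e ∈ IsManifold.maximalAtlas 𝓘(ℝ, E4) ∞ M, ∀ μ ν : Fin 4,
    ContDiffOn ℝ ∞ (fun x => toFun (e.symm x) (coordFrame e x μ) (coordFrame e x ν)) e.target

namespace LorentzianMetric

variable (g : LorentzianMetric M)

/-- The components `g_{μν}` in the chart `e`, as functions of the coordinates. -/
def comp (e : OpenPartialHomeomorph M E4) (μ ν : Fin 4) (x : E4) : ℝ :=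
  g.toFun (e.symm x) (coordFrame e x μ) (coordFrame e x ν)

/-- The components `g^{μν}` of the inverse metric in the chart `e`. -/
def invComp (e : OpenPartialHomeomorph M E4) (μ ν : Fin 4) (x : E4) : ℝ :=
  (Matrix.of fun α β => g.comp e α β x)⁻¹ μ ν

/-- The Christoffel symbols `Γ^κ_{μν}` of the Levi-Civita connection in the chart `e`. -/
def christoffel (e : OpenPartialHomeomorph M E4) (κ μ ν : Fin 4) (x : E4) : ℝ :=
  (1 / 2) * ∑ σ, g.invComp e κ σ x *
    (partialDeriv μ (g.comp e σ ν) x + partialDeriv ν (g.comp e σ μ) x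
      - partialDeriv σ (g.comp e μ ν) x)

/-- The covariant derivative `∇_μ V^ν = ∂_μ V^ν + Γ^ν_{μκ} V^κ` in the chart `e`. -/
def covDeriv (e : OpenPartialHomeomorph M E4) (V : Field M) (μ ν : Fin 4) (x : E4) : ℝ :=
  partialDeriv μ (fun z => fieldComp e V z ν) x
    + ∑ κ, g.christoffel e ν μ κ x * fieldComp e V x κ

/-- The divergence `∇_μ V^μ` at `p`. It does not depend on the chart; it is computed in the
preferred chart at `p`. -/
def divergence (V : Field M) (p : M) : ℝ :=
  ∑ μ, g.covDeriv (chartAt E4 p) V μ μ (chartAt E4 p p)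

/-- `ξ` is a Killing field: in every smooth chart,
`(ℒ_ξ g)_{μν} = ξ^κ ∂_κ g_{μν} + g_{κν} ∂_μ ξ^κ + g_{μκ} ∂_ν ξ^κ = 0`. -/
def IsKilling (ξ : Field M) : Prop :=
  ∀ e ∈ IsManifold.maximalAtlas 𝓘(ℝ, E4) ∞ M, ∀ x ∈ e.target, ∀ μ ν : Fin 4,
    ∑ κ, (fieldComp e ξ x κ * partialDeriv κ (g.comp e μ ν) x
      + g.comp e κ ν x * partialDeriv μ (fun z => fieldComp e ξ z κ) x
      + g.comp e μ κ x * partialDeriv ν (fun z => fieldComp e ξ z κ) x) = 0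

/-- A metric volume form (Levi-Civita tensor) `ε_{αβγδ}` of `g`: a continuous four-form whose value
on any four vectors is, up to sign, the square root of minus their Gram determinant. Such a form is
the same thing as an orientation of the spacetime. -/
structure VolumeForm where
  /-- the alternating form on each tangent space -/
  toFun (p : M) : (TangentSpace 𝓘(ℝ, E4) p) [⋀^Fin 4]→ₗ[ℝ] ℝ
  sq (p : M) (v : Fin 4 → TangentSpace 𝓘(ℝ, E4) p) :
    toFun p v ^ 2 = - (Matrix.of fun i j => g.toFun p (v i) (v j)).det
  continuous : ∀ e ∈ IsManifold.maximalAtlas 𝓘(ℝ, E4) ∞ M,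
    ContinuousOn (fun x => toFun (e.symm x) (coordFrame e x)) e.target

/-- `H` is a smooth null hypersurface generated by `X`: near each of its points `p`, the set `H` is
the zero set of a smooth function `f` whose differential at `p` is `g(k, ·)` for a nonzero null
vector `k`, so that `T_p H` is the null hyperplane orthogonal to `k`, and `X` points along the null
generator direction `k`. As `X` is only required to be a multiple of `k`, it may vanish somewhere
on `H`, as a horizon generator does at a bifurcation sphere. -/
def IsNullHypersurfaceGeneratedBy (H : Set M) (X : Field M) : Prop :=
  ∀ p ∈ H, ∃ k : TangentSpace 𝓘(ℝ, E4) p, k ≠ 0 ∧ g.toFun p k k = 0 ∧ (∃ c : ℝ, X p = c • k) ∧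
    ∃ f : M → ℝ, ContMDiffAt 𝓘(ℝ, E4) 𝓘(ℝ, ℝ) ∞ f p ∧
      (∀ᶠ q in 𝓝 p, q ∈ H ↔ f q = 0) ∧
      ∀ v : TangentSpace 𝓘(ℝ, E4) p,
        (mfderiv 𝓘(ℝ, E4) 𝓘(ℝ, ℝ) f p v : ℝ) = g.toFun p k v

end LorentzianMetric

/-- The change from spherical coordinates `(t, r, θ, φ)` to `(t, x, y, z)`. -/
def sphericalMap (q : E4) : E4 :=
  !₂[q 0, q 1 * Real.sin (q 2) * Real.cos (q 3), q 1 * Real.sin (q 2) * Real.sin (q 3),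
    q 1 * Real.cos (q 2)]

/-- Coordinates on the asymptotic region, adapted to the Killing fields `t` and `φ`: a smooth chart
with values `(t, x, y, z)` running over all of `ℝ × {|(x, y, z)| > R₀}`, in which the field `t` is
`∂_t` and the field `φ` is the rotation field `x ∂_y - y ∂_x`. With
`(x, y, z) = r (sin θ cos φ, sin θ sin φ, cos θ)` this gives coordinates `(t, r, θ, φ)` in which the
two fields are `∂_t` and `∂_φ`; they are positively oriented. -/
structure AsymptoticChart (g : LorentzianMetric M) (vol : g.VolumeForm) (t φ : Field M) where
  /-- the chart -/
  chart : OpenPartialHomeomorph M E4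
  mem_maximalAtlas : chart ∈ IsManifold.maximalAtlas 𝓘(ℝ, E4) ∞ M
  /-- the coordinates cover `r > R₀` -/
  R₀ : ℝ
  R₀_pos : 0 < R₀
  target_eq : chart.target = {x : E4 | R₀ < ‖spatial x‖}
  time : ∀ x ∈ chart.target, fieldComp chart t x = !₂[1, 0, 0, 0]
  rotation : ∀ x ∈ chart.target, fieldComp chart φ x = !₂[0, -(x 2), x 1, 0]
  oriented : ∀ x ∈ chart.target, 0 < vol.toFun (chart.symm x) (coordFrame chart x)

namespace AsymptoticChart

variable {g : LorentzianMetric M} {vol : g.VolumeForm} {t φ : Field M}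
  (c : AsymptoticChart g vol t φ)

/-- The metric components `g_{ab}` in the coordinates `(t, r, θ, φ)`. -/
def sphericalComp (q : E4) (a b : Fin 4) : ℝ :=
  ∑ μ, ∑ ν, fderiv ℝ sphericalMap q (basisVec a) μ * fderiv ℝ sphericalMap q (basisVec b) ν
    * g.comp c.chart μ ν (sphericalMap q)

/-- `√(-g)` in the coordinates `(t, r, θ, φ)`. -/
def sqrtNegDet (q : E4) : ℝ :=
  Real.sqrt (-(Matrix.of (c.sphericalComp q)).det)

/-- The component `J^r = J^μ ∂_μ r` in the coordinates `(t, r, θ, φ)`. -/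
def radialComp (J : Field M) (q : E4) : ℝ :=
  fderiv ℝ (fun x : E4 => ‖spatial x‖) (sphericalMap q) (fieldComp c.chart J (sphericalMap q))

/-- `∫ J^r √(-g) dθ dφ` over the sphere with coordinates `t = t₀` and `r`. -/
def sphereFlux (J : Field M) (t₀ r : ℝ) : ℝ :=
  ∫ θ in (0 : ℝ)..Real.pi, ∫ ϕ in (0 : ℝ)..(2 * Real.pi),
    c.radialComp J !₂[t₀, r, θ, ϕ] * c.sqrtNegDet !₂[t₀, r, θ, ϕ]

end AsymptoticChart

/-- The closed exterior `{|y| ≥ 1}` of the unit ball of `ℝ³`, diffeomorphic to `[1, ∞) × S²`. -/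
def exteriorDomain : Set E3 := {y | 1 ≤ ‖y‖}

/-- A smooth embedded hypersurface with boundary that runs from the horizon `H` to spatial infinity,
given by a parametrization on `{|y| ≥ 1}`: the boundary sphere `|y| = 1` is mapped into `H`, and
outside a compact set the hypersurface is a graph `t = h(x, y, z)` over the whole of `{r > R₁}` in
the asymptotic coordinates. No causality condition is imposed; a partial Cauchy surface is the
special case of a spacelike hypersurface that no causal curve meets twice. -/
structure HorizonToInfinity {g : LorentzianMetric M} {vol : g.VolumeForm} {t φ : Field M}
    (H : Set M) (c : AsymptoticChart g vol t φ) where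
  /-- the parametrization -/
  param : E3 → M
  smooth : ∀ y ∈ exteriorDomain, ContMDiffAt 𝓘(ℝ, E3) 𝓘(ℝ, E4) ∞ param y
  embedding : IsEmbedding (exteriorDomain.domRestrict param)
  immersion : ∀ y ∈ exteriorDomain, Function.Injective (mfderiv 𝓘(ℝ, E3) 𝓘(ℝ, E4) param y)
  boundary : ∀ y : E3, ‖y‖ = 1 → param y ∈ H
  /-- the graph condition holds for `r > R₁` -/
  R₁ : ℝ
  graph : ∀ y ∈ exteriorDomain, R₁ < ‖y‖ →
    param y ∈ c.chart.source ∧ spatial (c.chart (param y)) = y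

namespace HorizonToInfinity

variable {g : LorentzianMetric M} {vol : g.VolumeForm} {t φ : Field M}
  {H : Set M} {c : AsymptoticChart g vol t φ} (N : HorizonToInfinity H c)

/-- The density of `X^μ dΣ_μ` with respect to the parameters `y`. Here
`dΣ_μ = ε_{μαβγ} (∂_1 ψ)^α (∂_2 ψ)^β (∂_3 ψ)^γ d³y` is the oriented surface element of the
hypersurface `ψ`; on a slice of constant `t` it equals `∂_μ t √(-g) d³x`. -/
def fluxDensity (X : Field M) (y : E3) : ℝ :=
  vol.toFun (N.param y) ![X (N.param y),
    mfderiv 𝓘(ℝ, E3) 𝓘(ℝ, E4) N.param y (basisVec3 0),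
    mfderiv 𝓘(ℝ, E3) 𝓘(ℝ, E4) N.param y (basisVec3 1),
    mfderiv 𝓘(ℝ, E3) 𝓘(ℝ, E4) N.param y (basisVec3 2)]

/-- The integral `∫_Σ F X^μ dΣ_μ` converges (absolutely). -/
def FluxIntegrable (F : M → ℝ) (X : Field M) : Prop :=
  IntegrableOn (fun y => F (N.param y) * N.fluxDensity X y) exteriorDomain volume

/-- The integral `∫_Σ F X^μ dΣ_μ`. -/
def fluxIntegral (F : M → ℝ) (X : Field M) : ℝ :=
  ∫ y in exteriorDomain, F (N.param y) * N.fluxDensity X y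

end HorizonToInfinity

end Manifold

end KillingFlux

end

/-! The identity is Stokes' theorem on `Σ` for the two-form `ω = vol (J, X, ·, ·)`. Killing flows
preserve `vol`, and `X = t + Ω φ` commutes with `J`; by Cartan's formula only the divergence of `J`
survives in the exterior derivative, so `dω = ε S vol (X, ·, ·, ·)`, the integrand on the right.
This is computed in a chart in `sum_fderiv_det4_comp`, with the density facts `killing_volDensity`
and `divergence_volDensity`, and transported to `Σ` in `sum_fderiv_pulledFlux`.

The boundary sphere in `H` contributes nothing. There `X` is a multiple of the null normal `k`, so
if `X ≠ 0` then `X`, `J` and both tangent vectors of the sphere lie in the three-dimensional space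
`k^⊥`, on which a four-form vanishes; if `X = 0` the form vanishes anyway (`pulledFlux_boundary`).

On the sphere `r = R` of `Σ`, written as a graph `t = h`, the form `ω` is `-(1 - Ω ∂_φ h) J^r √(-g)
dθ dφ`. The factor `J^r √(-g)` depends on neither `t` nor `φ`, so it may be evaluated at `t = t₀`,
and the term with `∂_φ h` integrates to zero around each circle (`integral_pulledFlux_eq`).

Hence the part of `Σ` with `|y| ≤ R` satisfies the identity exactly for all large `R`, and absolute
convergence gives the limit (`tendsto_integral_shell`). Stokes' theorem itself is the divergence
theorem on a box of spherical coordinates (`integral_box`), converted to an integral over a shell by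
`integral_shell`. -/

noncomputable section

namespace KillingFlux

set_option linter.unusedSectionVars false

/-! ### Determinants in `ℝ⁴` and the exterior derivative of `D det (J, X, ·, ·)`. -/

/-- The determinant of four vectors of `ℝ⁴`. -/
def det4 (a b c d : E4) : ℝ :=
  (Matrix.of ![a.ofLp, b.ofLp, c.ofLp, d.ofLp]).det

lemma det4_expand (a b c d : E4) : det4 a b c d =
    a 0 * (b 1 * (c 2 * d 3 - c 3 * d 2) - b 2 * (c 1 * d 3 - c 3 * d 1)
        + b 3 * (c 1 * d 2 - c 2 * d 1))
    - a 1 * (b 0 * (c 2 * d 3 - c 3 * d 2) - b 2 * (c 0 * d 3 - c 3 * d 0)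
        + b 3 * (c 0 * d 2 - c 2 * d 0))
    + a 2 * (b 0 * (c 1 * d 3 - c 3 * d 1) - b 1 * (c 0 * d 3 - c 3 * d 0)
        + b 3 * (c 0 * d 1 - c 1 * d 0))
    - a 3 * (b 0 * (c 1 * d 2 - c 2 * d 1) - b 1 * (c 0 * d 2 - c 2 * d 0)
        + b 2 * (c 0 * d 1 - c 1 * d 0)) := by
  simp [det4, Matrix.det_succ_row_zero, Fin.sum_univ_succ, Fin.succAbove]
  ring

lemma apply_eq_sum {F : Type*} [AddCommGroup F] [Module ℝ F] [TopologicalSpace F]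
    (L : E4 →L[ℝ] F) (u : E4) :
    L u = ∑ μ, u μ • L (basisVec μ) := by
  conv_lhs => rw [← (EuclideanSpace.basisFun (Fin 4) ℝ).sum_repr u]
  simp [basisVec]

lemma apply_coord_eq_sum (L : E4 →L[ℝ] E4) (u : E4) (ν : Fin 4) :
    L u ν = ∑ μ, u μ * L (basisVec μ) ν := by
  rw [apply_eq_sum L u]
  simp

/-- The trace of an endomorphism of `ℝ⁴`. -/
def tr4 (A : E4 →L[ℝ] E4) : ℝ := ∑ μ, A (basisVec μ) μ

/-- The derivative at `s = 0` of `det (e^{sA}) = e^{s tr A}`: an endomorphism acts on the top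
exterior power by its trace. -/
lemma det4_trace (A : E4 →L[ℝ] E4) (a b c d : E4) :
    tr4 A * det4 a b c d =
      det4 (A a) b c d + det4 a (A b) c d + det4 a b (A c) d + det4 a b c (A d) := by
  simp only [det4_expand, apply_coord_eq_sum A a, apply_coord_eq_sum A b, apply_coord_eq_sum A c,
    apply_coord_eq_sum A d, tr4, Fin.sum_univ_four]
  ring

/-- This is `l ∧ det`, a five-form on a four-dimensional space. It trades derivatives of the density
along tangent vectors for those along `J` and `X`. -/
lemma det4_linear_form (l : E4 →L[ℝ] ℝ) (a b c d f : E4) :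
    l a * det4 b c d f - l b * det4 a c d f + l c * det4 a b d f - l d * det4 a b c f
      + l f * det4 a b c d = 0 := by
  rw [apply_eq_sum l a, apply_eq_sum l b, apply_eq_sum l c, apply_eq_sum l d, apply_eq_sum l f]
  simp only [det4_expand, Fin.sum_univ_four, smul_eq_mul]
  ring

lemma contDiffAt_det4 {E : Type*} [NormedAddCommGroup E] [NormedSpace ℝ E] {a b c d : E → E4}
    {q : E} {n : WithTop ℕ∞}
    (ha : ContDiffAt ℝ n a q) (hb : ContDiffAt ℝ n b q) (hc : ContDiffAt ℝ n c q)
    (hd : ContDiffAt ℝ n d q) : ContDiffAt ℝ n (fun z => det4 (a z) (b z) (c z) (d z)) q := by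
  have h (f : E → E4) (hf : ContDiffAt ℝ n f q) (μ : Fin 4) : ContDiffAt ℝ n (fun z => f z μ) q :=
    ((EuclideanSpace.proj μ : E4 →L[ℝ] ℝ).contDiff.contDiffAt).comp q hf
  have ha' := h a ha
  have hb' := h b hb
  have hc' := h c hc
  have hd' := h d hd
  simp only [det4_expand]
  fun_prop

/-- The determinant of `n × n` matrices, as a continuous multilinear function of the rows. -/
def detRows (n : ℕ) : ContinuousMultilinearMap ℝ (fun _ : Fin n => Fin n → ℝ) ℝ :=
  { (Matrix.detRowAlternating (n := Fin n) (R := ℝ)).toMultilinearMap with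
    cont := Continuous.matrix_det continuous_id }

lemma detRows_apply {n : ℕ} (A : Fin n → Fin n → ℝ) : detRows n A = (Matrix.of A).det := rfl

lemma hasFDerivAt_det {E : Type*} [NormedAddCommGroup E] [NormedSpace ℝ E] {n : ℕ}
    {A : Fin n → E → Fin n → ℝ} {A' : Fin n → E →L[ℝ] (Fin n → ℝ)} {q : E}
    (hA : ∀ i, HasFDerivAt (A i) (A' i) q) :
    HasFDerivAt (fun z => (Matrix.of fun i => A i z).det)
      (∑ i, ((detRows n).toContinuousLinearMap (fun j => A j q) i).comp (A' i)) q :=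
  HasFDerivAt.multilinear_comp (f := detRows n) hA

lemma hasFDerivAt_ofLp {E : Type*} [NormedAddCommGroup E] [NormedSpace ℝ E] {a : E → E4} {q : E}
    (ha : DifferentiableAt ℝ a q) :
    HasFDerivAt (fun z => (a z).ofLp)
      ((EuclideanSpace.equiv (Fin 4) ℝ : E4 →L[ℝ] (Fin 4 → ℝ)).comp (fderiv ℝ a q)) q :=
  ((EuclideanSpace.equiv (Fin 4) ℝ : E4 →L[ℝ] (Fin 4 → ℝ)).hasFDerivAt).comp q ha.hasFDerivAt

lemma det4_eq_detRows (a b c d : E4) :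
    det4 a b c d = detRows 4 fun i => (![a, b, c, d] i).ofLp := by
  rw [detRows_apply, det4]
  congr 2
  funext i
  fin_cases i <;> rfl

lemma detRows_update (a : Fin 4 → E4) (i : Fin 4) (x : E4) :
    detRows 4 (Function.update (fun j => (a j).ofLp) i x.ofLp)
      = detRows 4 fun j => (Function.update a i x j).ofLp := by
  congr 1
  funext j
  by_cases h : j = i
  · subst h; simp
  · simp [Function.update_of_ne h]

lemma fderiv_det4 {E : Type*} [NormedAddCommGroup E] [NormedSpace ℝ E] {a b c d : E → E4} {q : E}
    (ha : DifferentiableAt ℝ a q) (hb : DifferentiableAt ℝ b q) (hc : DifferentiableAt ℝ c q)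
    (hd : DifferentiableAt ℝ d q) (v : E) :
    fderiv ℝ (fun z => det4 (a z) (b z) (c z) (d z)) q v =
      det4 (fderiv ℝ a q v) (b q) (c q) (d q) + det4 (a q) (fderiv ℝ b q v) (c q) (d q)
      + det4 (a q) (b q) (fderiv ℝ c q v) (d q) + det4 (a q) (b q) (c q) (fderiv ℝ d q v) := by
  have hdiff : ∀ i, DifferentiableAt ℝ (fun z => ![a z, b z, c z, d z] i) q := by
    intro i
    fin_cases i
    exacts [ha, hb, hc, hd]
  have key := HasFDerivAt.multilinear_comp (f := detRows 4)
    (fun i => hasFDerivAt_ofLp (hdiff i))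
  simp only [det4_eq_detRows]
  rw [key.fderiv, sum_apply, Fin.sum_univ_four]
  have hterm (i : Fin 4) (x : E4) :
      ((detRows 4).toContinuousLinearMap (fun j => (![a q, b q, c q, d q] j).ofLp) i) x.ofLp
        = detRows 4 fun j => (Function.update ![a q, b q, c q, d q] i x j).ofLp :=
    detRows_update _ i x
  refine congrArg₂ _ (congrArg₂ _ (congrArg₂ _ ?_ ?_) ?_) ?_
  · refine (hterm 0 (fderiv ℝ a q v)).trans (congrArg _ ?_)
    funext j; fin_cases j <;> rfl
  · refine (hterm 1 (fderiv ℝ b q v)).trans (congrArg _ ?_)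
    funext j; fin_cases j <;> rfl
  · refine (hterm 2 (fderiv ℝ c q v)).trans (congrArg _ ?_)
    funext j; fin_cases j <;> rfl
  · refine (hterm 3 (fderiv ℝ d q v)).trans (congrArg _ ?_)
    funext j; fin_cases j <;> rfl

/-- Pulling back the two-form `D · det (J, X, ·, ·)` along `y`: if `[J, X] = 0`, if `X` has
divergence zero and `J` has divergence `-s` for the density `D`, then the exterior derivative of the
pullback is the pullback of `s D · det (X, ·, ·, ·)`. -/
lemma sum_fderiv_det4_comp {D : E4 → ℝ} {J X : E4 → E4} {y : (Fin 3 → ℝ) → E4} {q : Fin 3 → ℝ}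
    (hy : ContDiffAt ℝ 2 y q)
    (hD : DifferentiableAt ℝ D (y q)) (hJ : DifferentiableAt ℝ J (y q))
    (hX : DifferentiableAt ℝ X (y q)) {s : ℝ}
    (hJX : fderiv ℝ J (y q) (X (y q)) = fderiv ℝ X (y q) (J (y q)))
    (hdX : fderiv ℝ D (y q) (X (y q)) + D (y q) * tr4 (fderiv ℝ X (y q)) = 0)
    (hdJ : fderiv ℝ D (y q) (J (y q)) + D (y q) * tr4 (fderiv ℝ J (y q)) = - (s * D (y q))) :
    ∑ i : Fin 3, fderiv ℝ (fun z => D (y z) * det4 (J (y z)) (X (y z))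
        (fderiv ℝ y z (Pi.single (i + 1) 1)) (fderiv ℝ y z (Pi.single (i + 2) 1))) q
          (Pi.single i 1) =
      s * (D (y q) * det4 (X (y q)) (fderiv ℝ y q (Pi.single 0 1)) (fderiv ℝ y q (Pi.single 1 1))
        (fderiv ℝ y q (Pi.single 2 1))) := by
  have hyd : DifferentiableAt ℝ y q := hy.differentiableAt (by norm_num)
  have hdy : DifferentiableAt ℝ (fderiv ℝ y) q :=
    (hy.fderiv_right (m := 1) (by norm_num)).differentiableAt (by norm_num)
  have hpart (v : Fin 3 → ℝ) : DifferentiableAt ℝ (fun z => fderiv ℝ y z v) q :=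
    hdy.clm_apply (differentiableAt_const v)
  have hpart' (v w : Fin 3 → ℝ) :
      fderiv ℝ (fun z => fderiv ℝ y z v) q w = fderiv ℝ (fderiv ℝ y) q w v := by
    rw [fderiv_clm_apply hdy (differentiableAt_const v)]
    simp
  -- Symmetry of second derivatives is what cancels all terms with `∂²y` in the cyclic sum, as in `d
  -- ∘ d = 0`.
  have hsymm (v w : Fin 3 → ℝ) :
      fderiv ℝ (fderiv ℝ y) q w v = fderiv ℝ (fderiv ℝ y) q v w :=
    (hy.isSymmSndFDerivAt (by simp)) w v
  have hDy : DifferentiableAt ℝ (fun z => D (y z)) q := hD.comp q hyd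
  have hJy : DifferentiableAt ℝ (fun z => J (y z)) q := hJ.comp q hyd
  have hXy : DifferentiableAt ℝ (fun z => X (y z)) q := hX.comp q hyd
  have hDy' (v) : fderiv ℝ (fun z => D (y z)) q v = fderiv ℝ D (y q) (fderiv ℝ y q v) := by
    rw [show (fun z => D (y z)) = D ∘ y from rfl, fderiv_comp q hD hyd]; rfl
  have hJy' (v) : fderiv ℝ (fun z => J (y z)) q v = fderiv ℝ J (y q) (fderiv ℝ y q v) := by
    rw [show (fun z => J (y z)) = J ∘ y from rfl, fderiv_comp q hJ hyd]; rfl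
  have hXy' (v) : fderiv ℝ (fun z => X (y z)) q v = fderiv ℝ X (y q) (fderiv ℝ y q v) := by
    rw [show (fun z => X (y z)) = X ∘ y from rfl, fderiv_comp q hX hyd]; rfl
  have hterm (u v w : Fin 3 → ℝ) : fderiv ℝ (fun z => D (y z) * det4 (J (y z)) (X (y z))
        (fderiv ℝ y z v) (fderiv ℝ y z w)) q u =
      D (y q) * (det4 (fderiv ℝ J (y q) (fderiv ℝ y q u)) (X (y q)) (fderiv ℝ y q v)
          (fderiv ℝ y q w)
        + det4 (J (y q)) (fderiv ℝ X (y q) (fderiv ℝ y q u)) (fderiv ℝ y q v) (fderiv ℝ y q w)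
        + det4 (J (y q)) (X (y q)) (fderiv ℝ (fderiv ℝ y) q u v) (fderiv ℝ y q w)
        + det4 (J (y q)) (X (y q)) (fderiv ℝ y q v) (fderiv ℝ (fderiv ℝ y) q u w))
      + fderiv ℝ D (y q) (fderiv ℝ y q u) *
        det4 (J (y q)) (X (y q)) (fderiv ℝ y q v) (fderiv ℝ y q w) := by
    have hdet : DifferentiableAt ℝ (fun z => det4 (J (y z)) (X (y z))
        (fderiv ℝ y z v) (fderiv ℝ y z w)) q := by
      have hco (f : (Fin 3 → ℝ) → E4) (hf : DifferentiableAt ℝ f q) (μ : Fin 4) :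
          DifferentiableAt ℝ (fun z => f z μ) q :=
        ((EuclideanSpace.proj μ : E4 →L[ℝ] ℝ).differentiableAt).comp q hf
      have h1 := hco _ hJy
      have h2 := hco _ hXy
      have h3 := hco _ (hpart v)
      have h4 := hco _ (hpart w)
      simp only [det4_expand]
      fun_prop
    rw [fderiv_fun_mul hDy hdet]
    simp only [add_apply, smul_apply, smul_eq_mul,
      fderiv_det4 hJy hXy (hpart v) (hpart w), hDy', hJy', hXy', hpart']
    ring
  simp only [Fin.sum_univ_three, hterm, zero_add, Fin.isValue,
    show (1 : Fin 3) + 1 = 2 from rfl, show (1 : Fin 3) + 2 = 0 from rfl,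
    show (2 : Fin 3) + 1 = 0 from rfl, show (2 : Fin 3) + 2 = 1 from rfl]
  rw [hsymm (Pi.single 0 1) (Pi.single 1 1), hsymm (Pi.single 0 1) (Pi.single 2 1),
    hsymm (Pi.single 1 1) (Pi.single 2 1)]
  set u := fderiv ℝ y q (Pi.single 0 1)
  set v := fderiv ℝ y q (Pi.single 1 1)
  set w := fderiv ℝ y q (Pi.single 2 1)
  generalize fderiv ℝ (fderiv ℝ y) q (Pi.single 0 1) (Pi.single 1 1) = p01
  generalize fderiv ℝ (fderiv ℝ y) q (Pi.single 0 1) (Pi.single 2 1) = p02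
  generalize fderiv ℝ (fderiv ℝ y) q (Pi.single 1 1) (Pi.single 2 1) = p12
  have tJ := det4_trace (fderiv ℝ J (y q)) (X (y q)) u v w
  have tX := det4_trace (fderiv ℝ X (y q)) (J (y q)) u v w
  have hl := det4_linear_form (fderiv ℝ D (y q)) (J (y q)) (X (y q)) u v w
  -- After this rewriting the term with `DX J` occurs in both `tJ` and `tX` and drops out of their
  -- difference.
  rw [hJX] at tJ
  -- The determinants are brought to a common order of arguments, so that the remaining identity is
  -- linear in them.
  have swap (a b c d : E4) : det4 a b c d = - det4 b a c d := by
    simp only [det4_expand]; ring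
  have cyc (a b c d : E4) : det4 a b c d = det4 a d b c := by
    simp only [det4_expand]; ring
  have swap' (a b c d : E4) : det4 a b c d = - det4 a b d c := by
    simp only [det4_expand]; ring
  rw [swap _ (X (y q)) v w, swap _ (X (y q)) w u, swap _ (X (y q)) u v,
    cyc (X (y q)) _ w u, ← cyc (X (y q)) u v, cyc (J (y q)) _ w u, ← cyc (J (y q)) u v,
    swap' _ _ p01 w, swap' _ _ p12 u, swap' _ _ p02 v, swap' _ _ w u]
  linear_combination hl + D (y q) * (tJ - tX) - det4 (X (y q)) u v w * hdJ
    + det4 (J (y q)) u v w * hdX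

/-! ### The metric density in a chart, Killing fields and the divergence. -/

section ChartGeometry

variable {M : Type*} [TopologicalSpace M] [ChartedSpace E4 M] [IsManifold 𝓘(ℝ, E4) ∞ M]
  {e : OpenPartialHomeomorph M E4}

lemma mdifferentiable_of_mem (he : e ∈ IsManifold.maximalAtlas 𝓘(ℝ, E4) ∞ M) :
    e.MDifferentiable 𝓘(ℝ, E4) 𝓘(ℝ, E4) :=
  ⟨(contMDiffOn_of_mem_maximalAtlas he).mdifferentiableOn (by simp),
    (contMDiffOn_symm_of_mem_maximalAtlas he).mdifferentiableOn (by simp)⟩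

lemma mfderiv_symm_mfderiv (he : e ∈ IsManifold.maximalAtlas 𝓘(ℝ, E4) ∞ M) {x : E4}
    (hx : x ∈ e.target) (v : TangentSpace 𝓘(ℝ, E4) (e.symm x)) :
    mfderiv 𝓘(ℝ, E4) 𝓘(ℝ, E4) e.symm x (mfderiv 𝓘(ℝ, E4) 𝓘(ℝ, E4) e (e.symm x) v) = v := by
  have h := (mdifferentiable_of_mem he).symm_comp_deriv (e.map_target hx)
  rw [e.right_inv hx] at h
  exact DFunLike.congr_fun h v

lemma mfderiv_mfderiv_symm (he : e ∈ IsManifold.maximalAtlas 𝓘(ℝ, E4) ∞ M) {x : E4}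
    (hx : x ∈ e.target) (v : E4) :
    mfderiv 𝓘(ℝ, E4) 𝓘(ℝ, E4) e (e.symm x) (mfderiv 𝓘(ℝ, E4) 𝓘(ℝ, E4) e.symm x v) = v :=
  DFunLike.congr_fun ((mdifferentiable_of_mem he).comp_symm_deriv hx) v

variable {g : LorentzianMetric M} (vol : g.VolumeForm)

/-- The density `±√(-g)` of the volume form in the chart `e`. -/
def volDensity (e : OpenPartialHomeomorph M E4) (x : E4) : ℝ :=
  vol.toFun (e.symm x) (coordFrame e x)

/-- Alternating four-forms on `ℝ⁴` form a line, so the pulled-back form is fixed by its value on the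
standard basis. -/
lemma vol_mfderiv_symm (x : E4) (v : Fin 4 → E4) :
    vol.toFun (e.symm x) (fun i => mfderiv 𝓘(ℝ, E4) 𝓘(ℝ, E4) e.symm x (v i)) =
      volDensity vol e x * det4 (v 0) (v 1) (v 2) (v 3) := by
  let A : E4 [⋀^Fin 4]→ₗ[ℝ] ℝ := (vol.toFun (e.symm x)).compLinearMap
    (mfderiv 𝓘(ℝ, E4) 𝓘(ℝ, E4) e.symm x).toLinearMap
  have h := A.eq_smul_basis_det (EuclideanSpace.basisFun (Fin 4) ℝ).toBasis
  have h1 := DFunLike.congr_fun h v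
  have h2 : A v = vol.toFun (e.symm x) (fun i => mfderiv 𝓘(ℝ, E4) 𝓘(ℝ, E4) e.symm x (v i)) := rfl
  have h3 : A (EuclideanSpace.basisFun (Fin 4) ℝ).toBasis = volDensity vol e x := by
    simp only [OrthonormalBasis.coe_toBasis]
    change vol.toFun (e.symm x) _ = vol.toFun (e.symm x) _
    congr 1
    funext i
    simp [coordFrame, basisVec]
    rfl
  rw [← h2, h1, AlternatingMap.smul_apply, h3, smul_eq_mul, Module.Basis.det_apply]
  congr 1
  rw [← Matrix.det_transpose, det4]
  congr 1
  ext i j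
  fin_cases i <;> simp [Module.Basis.toMatrix_apply]

lemma vol_eq (he : e ∈ IsManifold.maximalAtlas 𝓘(ℝ, E4) ∞ M) {x : E4} (hx : x ∈ e.target)
    (v : Fin 4 → TangentSpace 𝓘(ℝ, E4) (e.symm x)) :
    vol.toFun (e.symm x) v = volDensity vol e x *
      det4 (mfderiv 𝓘(ℝ, E4) 𝓘(ℝ, E4) e (e.symm x) (v 0))
        (mfderiv 𝓘(ℝ, E4) 𝓘(ℝ, E4) e (e.symm x) (v 1))
        (mfderiv 𝓘(ℝ, E4) 𝓘(ℝ, E4) e (e.symm x) (v 2))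
        (mfderiv 𝓘(ℝ, E4) 𝓘(ℝ, E4) e (e.symm x) (v 3)) := by
  have h := vol_mfderiv_symm (e := e) vol x
    (fun i => mfderiv 𝓘(ℝ, E4) 𝓘(ℝ, E4) e (e.symm x) (v i))
  simpa only [mfderiv_symm_mfderiv he hx] using h

lemma volDensity_sq (x : E4) :
    volDensity vol e x ^ 2 = - (Matrix.of fun μ ν => g.comp e μ ν x).det :=
  vol.sq _ _

/-- On an orthonormal Lorentz frame the Gram determinant is `-1`, so `vol` takes the value `±1`
there and its density cannot vanish. -/
lemma volDensity_ne_zero (he : e ∈ IsManifold.maximalAtlas 𝓘(ℝ, E4) ∞ M) {x : E4}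
    (hx : x ∈ e.target) : volDensity vol e x ≠ 0 := by
  intro h0
  obtain ⟨b, hb⟩ := g.signature (e.symm x)
  have h1 := vol.sq (e.symm x) b
  rw [vol_eq vol he hx, h0] at h1
  have h2 : (Matrix.of fun i j => g.toFun (e.symm x) (b i) (b j)) =
      Matrix.diagonal ![-1, 1, 1, 1] := by
    ext i j
    simp only [Matrix.of_apply, hb, Matrix.diagonal_apply]
    fin_cases i <;> simp
  rw [h2, Matrix.det_diagonal] at h1
  simp [Fin.prod_univ_four] at h1

/-- A continuous nonvanishing `f` keeps its sign locally and so equals `√h` or `-√h`. This is why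
continuity of the volume form already gives smoothness. -/
lemma contDiffAt_of_sq {E : Type*} [NormedAddCommGroup E] [NormedSpace ℝ E] {f h : E → ℝ} {x : E}
    {n : WithTop ℕ∞}
    (hf : ContinuousAt f x) (h0 : f x ≠ 0) (hsq : ∀ᶠ z in 𝓝 x, f z ^ 2 = h z)
    (hh : ContDiffAt ℝ n h x) : ContDiffAt ℝ n f x := by
  have hx : h x ≠ 0 := by rw [← hsq.self_of_nhds]; positivity
  rcases lt_or_gt_of_ne h0 with h0 | h0
  · refine (hh.sqrt hx).neg.congr_of_eventuallyEq ?_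
    filter_upwards [hsq, hf.eventually (gt_mem_nhds h0)] with z hz hz'
    rw [← hz, Real.sqrt_sq_eq_abs, abs_of_neg hz', neg_neg]
  · refine (hh.sqrt hx).congr_of_eventuallyEq ?_
    filter_upwards [hsq, hf.eventually (lt_mem_nhds h0)] with z hz hz'
    rw [← hz, Real.sqrt_sq_eq_abs, abs_of_pos hz']

variable (g) in
lemma contDiffAt_comp (he : e ∈ IsManifold.maximalAtlas 𝓘(ℝ, E4) ∞ M) {x : E4}
    (hx : x ∈ e.target) (μ ν : Fin 4) : ContDiffAt ℝ ∞ (g.comp e μ ν) x :=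
  (g.smooth e he μ ν).contDiffAt (e.open_target.mem_nhds hx)

lemma contDiffAt_volDensity (he : e ∈ IsManifold.maximalAtlas 𝓘(ℝ, E4) ∞ M) {x : E4}
    (hx : x ∈ e.target) : ContDiffAt ℝ ∞ (volDensity vol e) x := by
  refine contDiffAt_of_sq ((vol.continuous e he).continuousAt (e.open_target.mem_nhds hx))
    (volDensity_ne_zero vol he hx) (Eventually.of_forall fun z => volDensity_sq vol z) ?_
  exact ((detRows 4).contDiff.contDiffAt.comp x (contDiffAt_pi.2 fun μ => contDiffAt_pi.2 fun ν =>
    contDiffAt_comp g he hx μ ν)).neg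

lemma isInvertible_mfderiv_symm (he : e ∈ IsManifold.maximalAtlas 𝓘(ℝ, E4) ∞ M) {x : E4}
    (hx : x ∈ e.target) : (mfderiv 𝓘(ℝ, E4) 𝓘(ℝ, E4) e.symm x).IsInvertible :=
  ContinuousLinearMap.IsInvertible.of_inverse
    (g := mfderiv 𝓘(ℝ, E4) 𝓘(ℝ, E4) e (e.symm x))
    (ContinuousLinearMap.ext (mfderiv_symm_mfderiv he hx))
    (ContinuousLinearMap.ext (mfderiv_mfderiv_symm he hx))

/-- The link to `VectorField.mpullback`, whose regularity and compatibility with Lie brackets can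
then be used for components. -/
lemma fieldComp_eq_mpullback (he : e ∈ IsManifold.maximalAtlas 𝓘(ℝ, E4) ∞ M) (V : Field M) {x : E4}
    (hx : x ∈ e.target) :
    VectorField.mpullback 𝓘(ℝ, E4) 𝓘(ℝ, E4) e.symm V x = fieldComp e V x :=
  DFunLike.congr_fun (ContinuousLinearMap.inverse_eq
    (g := mfderiv 𝓘(ℝ, E4) 𝓘(ℝ, E4) e (e.symm x))
    (ContinuousLinearMap.ext (mfderiv_symm_mfderiv he hx))
    (ContinuousLinearMap.ext (mfderiv_mfderiv_symm he hx))) (V (e.symm x))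

lemma contDiffAt_fieldComp (he : e ∈ IsManifold.maximalAtlas 𝓘(ℝ, E4) ∞ M) {V : Field M}
    (hV : IsSmoothField 1 V) {x : E4} (hx : x ∈ e.target) :
    ContDiffAt ℝ 1 (fieldComp e V) x := by
  have : IsManifold 𝓘(ℝ, E4) 2 M := IsManifold.of_le (n := ∞) (WithTop.coe_le_coe.2 le_top)
  have h := ContMDiffAt.mpullback_vectorField_preimage (f := e.symm) (x₀ := x) (n := 2)
    (hV (e.symm x)) ((contMDiffOn_symm_of_mem_maximalAtlas (n := 2)
      (IsManifold.maximalAtlas_subset_of_le (WithTop.coe_le_coe.2 le_top) he)).contMDiffAt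
        (e.open_target.mem_nhds hx)) (isInvertible_mfderiv_symm he hx) (by norm_num)
  rw [contMDiffAt_vectorSpace_iff_contDiffAt] at h
  refine h.congr_of_eventuallyEq ?_
  filter_upwards [e.open_target.mem_nhds hx] with z hz
  exact (fieldComp_eq_mpullback he V hz).symm

/-- The Lie bracket is natural under pullback, and on `ℝ⁴` it is `DW V - DV W`. -/
lemma fderiv_fieldComp_comm (he : e ∈ IsManifold.maximalAtlas 𝓘(ℝ, E4) ∞ M) {V W : Field M}
    (hV : IsSmoothField 1 V) (hW : IsSmoothField 1 W) {x : E4} (hx : x ∈ e.target)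
    (h : VectorField.mlieBracket 𝓘(ℝ, E4) V W (e.symm x) = 0) :
    fderiv ℝ (fieldComp e W) x (fieldComp e V x) = fderiv ℝ (fieldComp e V) x (fieldComp e W x) := by
  have h3 : minSmoothness ℝ 3 ≤ ∞ := by
    rw [minSmoothness_of_isRCLikeNormedField]; exact WithTop.coe_le_coe.2 le_top
  have h2 : minSmoothness ℝ 2 ≤ ∞ := by
    rw [minSmoothness_of_isRCLikeNormedField]; exact WithTop.coe_le_coe.2 le_top
  have : IsManifold 𝓘(ℝ, E4) (minSmoothness ℝ 3) M := IsManifold.of_le h3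
  have key := VectorField.mpullback_mlieBracket (n := minSmoothness ℝ 2) (f := e.symm) (x₀ := x)
    ((hV (e.symm x)).mdifferentiableAt (by simp)) ((hW (e.symm x)).mdifferentiableAt (by simp))
    ((contMDiffOn_symm_of_mem_maximalAtlas
      (IsManifold.maximalAtlas_subset_of_le h2 he)).contMDiffAt
        (e.open_target.mem_nhds hx)) le_rfl
  have hE (U : Field M) : VectorField.mpullback 𝓘(ℝ, E4) 𝓘(ℝ, E4) e.symm U =ᶠ[𝓝 x]
      fieldComp e U := by
    filter_upwards [e.open_target.mem_nhds hx] with z hz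
    exact fieldComp_eq_mpullback he U hz
  rw [VectorField.mpullback_apply, h, map_zero, (hE V).mlieBracket_vectorField_eq (hE W)] at key
  have h4 : VectorField.mlieBracket 𝓘(ℝ, E4) (fieldComp e V) (fieldComp e W) x =
      VectorField.lieBracket ℝ (fieldComp e V) (fieldComp e W) x := by
    have h5 := VectorField.mlieBracketWithin_univ (I := 𝓘(ℝ, E4)) (V := fieldComp e V)
      (W := fieldComp e W)
    have h6 := VectorField.mlieBracketWithin_eq_lieBracketWithin (𝕜 := ℝ) (E := E4)
      (V := fieldComp e V) (W := fieldComp e W) (s := Set.univ)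
    have h7 := VectorField.lieBracketWithin_univ (𝕜 := ℝ) (V := fieldComp e V)
      (W := fieldComp e W)
    exact congrFun (h5.symm.trans (h6.trans h7)) x
  exact sub_eq_zero.mp (key.trans h4).symm

lemma comp_symm' (x : E4) (μ ν : Fin 4) : g.comp e μ ν x = g.comp e ν μ x :=
  g.symm _ _ _

lemma invComp_symm (x : E4) (μ ν : Fin 4) : g.invComp e μ ν x = g.invComp e ν μ x := by
  have h : (Matrix.of fun α β => g.comp e α β x).transpose =
      Matrix.of fun α β => g.comp e α β x := by
    ext i j
    exact comp_symm' x j i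
  unfold LorentzianMetric.invComp
  rw [← Matrix.transpose_apply (Matrix.of fun α β => g.comp e α β x)⁻¹ μ ν,
    Matrix.transpose_nonsing_inv, h]

include vol in
lemma isUnit_det_comp (he : e ∈ IsManifold.maximalAtlas 𝓘(ℝ, E4) ∞ M) {x : E4}
    (hx : x ∈ e.target) : IsUnit (Matrix.of fun μ ν => g.comp e μ ν x).det := by
  have h := volDensity_sq (e := e) vol x
  have h0 := volDensity_ne_zero vol he hx
  refine isUnit_iff_ne_zero.2 fun h1 => h0 ?_
  rw [h1] at h
  simpa using h

include vol in
lemma sum_invComp_comp (he : e ∈ IsManifold.maximalAtlas 𝓘(ℝ, E4) ∞ M) {x : E4}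
    (hx : x ∈ e.target) (μ κ : Fin 4) :
    ∑ ν, g.invComp e μ ν x * g.comp e ν κ x = if μ = κ then 1 else 0 := by
  have h := Matrix.nonsing_inv_mul _ (isUnit_det_comp vol he hx)
  have h1 := congrFun (congrFun h μ) κ
  rwa [Matrix.mul_apply, Matrix.one_apply] at h1

/-- Cramer's rule; it supplies the derivative of the determinant in Jacobi's formula. -/
lemma det_updateRow_eq_sum {n : ℕ} (A : Matrix (Fin n) (Fin n) ℝ) (hA : IsUnit A.det) (i : Fin n)
    (b : Fin n → ℝ) : (A.updateRow i b).det = A.det * ∑ j, A⁻¹ j i * b j := by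
  have h : (A.updateRow i b).det = ∑ j, A.adjugate j i * b j := by
    have h1 := congrFun (Matrix.cramer_eq_adjugate_mulVec A.transpose b) i
    rw [Matrix.cramer_transpose_apply, ← Matrix.adjugate_transpose] at h1
    simpa [Matrix.mulVec, dotProduct] using h1
  rw [h, Finset.mul_sum]
  refine Finset.sum_congr rfl fun j _ => ?_
  rw [Matrix.inv_def, Matrix.smul_apply, smul_eq_mul, ← mul_assoc, ← mul_assoc,
    Ring.mul_inverse_cancel _ hA, one_mul]

/-- Jacobi's formula `∂_v D = ½ D g^{μν} ∂_v g_{μν}` for the metric density. -/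
lemma fderiv_volDensity (he : e ∈ IsManifold.maximalAtlas 𝓘(ℝ, E4) ∞ M) {x : E4}
    (hx : x ∈ e.target) (v : E4) :
    fderiv ℝ (volDensity vol e) x v =
      (1 / 2) * volDensity vol e x * ∑ μ, ∑ ν, g.invComp e ν μ x * fderiv ℝ (g.comp e μ ν) x v := by
  have hd (μ ν) : DifferentiableAt ℝ (g.comp e μ ν) x :=
    (contDiffAt_comp g he hx μ ν).differentiableAt (by simp)
  have hD : DifferentiableAt ℝ (volDensity vol e) x :=
    (contDiffAt_volDensity vol he hx).differentiableAt (by simp)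
  have h1 := hasFDerivAt_det (A := fun μ z ν => g.comp e μ ν z)
    (fun μ => hasFDerivAt_pi.2 fun ν => (hd μ ν).hasFDerivAt)
  -- Differentiating `D² = -det g` instead of a square root avoids fixing the sign of `D`; one
  -- factor `D ≠ 0` is cancelled at the end.
  have h2 : HasFDerivAt (fun z => volDensity vol e z ^ 2) _ x := hD.hasFDerivAt.pow 2
  have h3 : (fun z => volDensity vol e z ^ 2) =
      fun z => - (Matrix.of fun μ ν => g.comp e μ ν z).det := funext fun z => volDensity_sq vol z
  rw [h3] at h2
  have h4 := DFunLike.congr_fun (h2.unique h1.neg) v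
  have hU := isUnit_det_comp vol he hx
  have h5 (μ : Fin 4) : (detRows 4) (Function.update (fun j ν => g.comp e j ν x) μ
      (fun ν => fderiv ℝ (g.comp e μ ν) x v)) =
      - volDensity vol e x ^ 2 * ∑ ν, g.invComp e ν μ x * fderiv ℝ (g.comp e μ ν) x v := by
    rw [volDensity_sq, neg_neg]
    exact det_updateRow_eq_sum _ hU μ _
  have h6 : (-(∑ i, ((detRows 4).toContinuousLinearMap (fun j ν => g.comp e j ν x) i).comp
      (ContinuousLinearMap.pi fun ν => fderiv ℝ (g.comp e i ν) x))) v =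
      - ∑ μ, - volDensity vol e x ^ 2 *
        ∑ ν, g.invComp e ν μ x * fderiv ℝ (g.comp e μ ν) x v := by
    rw [neg_apply, sum_apply]
    exact congrArg _ (Finset.sum_congr rfl fun μ _ => h5 μ)
  rw [h6, ← Finset.mul_sum] at h4
  have h0 := volDensity_ne_zero vol he hx
  simp only [smul_apply, smul_eq_mul] at h4
  norm_num at h4
  apply mul_left_cancel₀ h0
  linear_combination h4 / 2

lemma partialDeriv_fieldComp (he : e ∈ IsManifold.maximalAtlas 𝓘(ℝ, E4) ∞ M) {V : Field M}
    (hV : IsSmoothField 1 V) {x : E4} (hx : x ∈ e.target) (μ ν : Fin 4) :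
    partialDeriv μ (fun z => fieldComp e V z ν) x =
      fderiv ℝ (fieldComp e V) x (basisVec μ) ν := by
  have h := (contDiffAt_fieldComp he hV hx).differentiableAt (by simp)
  have h1 := ((EuclideanSpace.proj ν : E4 →L[ℝ] ℝ).hasFDerivAt).comp x h.hasFDerivAt
  exact DFunLike.congr_fun h1.fderiv (basisVec μ)

/-- The volume density is invariant under the flow of a Killing field. -/
lemma killing_volDensity (he : e ∈ IsManifold.maximalAtlas 𝓘(ℝ, E4) ∞ M) {ξ : Field M}
    (hξ : IsSmoothField 1 ξ) (hK : g.IsKilling ξ) {x : E4} (hx : x ∈ e.target) :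
    fderiv ℝ (volDensity vol e) x (fieldComp e ξ x) +
      volDensity vol e x * tr4 (fderiv ℝ (fieldComp e ξ) x) = 0 := by
  -- The trace of the Killing equation with `g^{μν}`: each of the two terms with `∂ξ` contributes
  -- one trace of `Dξ`.
  have h1 : ∑ μ, ∑ ν, g.invComp e ν μ x *
      fderiv ℝ (g.comp e μ ν) x (fieldComp e ξ x) = - 2 * tr4 (fderiv ℝ (fieldComp e ξ) x) := by
    have h2 (μ ν : Fin 4) : fderiv ℝ (g.comp e μ ν) x (fieldComp e ξ x) =
        - ∑ κ, (g.comp e κ ν x * fderiv ℝ (fieldComp e ξ) x (basisVec μ) κ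
          + g.comp e μ κ x * fderiv ℝ (fieldComp e ξ) x (basisVec ν) κ) := by
      have h3 := hK e he x hx μ ν
      simp only [partialDeriv_fieldComp he hξ hx, add_assoc] at h3
      rw [Finset.sum_add_distrib] at h3
      rw [apply_eq_sum (fderiv ℝ (g.comp e μ ν) x)]
      simp only [smul_eq_mul]
      exact eq_neg_of_add_eq_zero_left h3
    have hinv (κ μ : Fin 4) := sum_invComp_comp vol he hx κ μ
    have e1 (μ : Fin 4) : ∑ ν, g.invComp e ν μ x * ∑ κ, g.comp e κ ν x *
        fderiv ℝ (fieldComp e ξ) x (basisVec μ) κ =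
        fderiv ℝ (fieldComp e ξ) x (basisVec μ) μ := by
      simp only [Finset.mul_sum]
      rw [Finset.sum_comm]
      have (κ : Fin 4) : ∑ ν, g.invComp e ν μ x * (g.comp e κ ν x *
          fderiv ℝ (fieldComp e ξ) x (basisVec μ) κ) = (if μ = κ then 1 else 0) *
          fderiv ℝ (fieldComp e ξ) x (basisVec μ) κ := by
        rw [← hinv, Finset.sum_mul]
        refine Finset.sum_congr rfl fun ν _ => ?_
        rw [invComp_symm x ν μ, comp_symm' x κ ν]; ring
      simp [this]
    have e2 (ν : Fin 4) : ∑ μ, g.invComp e ν μ x * ∑ κ, g.comp e μ κ x *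
        fderiv ℝ (fieldComp e ξ) x (basisVec ν) κ =
        fderiv ℝ (fieldComp e ξ) x (basisVec ν) ν := by
      simp only [Finset.mul_sum]
      rw [Finset.sum_comm]
      have (κ : Fin 4) : ∑ μ, g.invComp e ν μ x * (g.comp e μ κ x *
          fderiv ℝ (fieldComp e ξ) x (basisVec ν) κ) = (if ν = κ then 1 else 0) *
          fderiv ℝ (fieldComp e ξ) x (basisVec ν) κ := by
        rw [← hinv, Finset.sum_mul]
        exact Finset.sum_congr rfl fun μ _ => by ring
      simp [this]
    simp only [h2, Finset.sum_add_distrib, mul_neg, mul_add, neg_add]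
    simp only [Finset.sum_neg_distrib, e1]
    rw [Finset.sum_comm]
    simp only [e2, tr4]
    ring
  rw [fderiv_volDensity vol he hx, h1]
  ring

/-- `D ∇_μ V^μ = ∂_μ (D V^μ)`. -/
lemma divergence_volDensity (he : e ∈ IsManifold.maximalAtlas 𝓘(ℝ, E4) ∞ M) {V : Field M}
    (hV : IsSmoothField 1 V) {x : E4} (hx : x ∈ e.target) :
    fderiv ℝ (volDensity vol e) x (fieldComp e V x) +
      volDensity vol e x * tr4 (fderiv ℝ (fieldComp e V) x) =
      volDensity vol e x * ∑ μ, g.covDeriv e V μ μ x := by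
  have h1 : ∑ μ, ∑ κ, g.christoffel e μ μ κ x * fieldComp e V x κ =
      (1 / 2) * ∑ μ, ∑ ν, g.invComp e ν μ x * fderiv ℝ (g.comp e μ ν) x (fieldComp e V x) := by
    have h2 (κ : Fin 4) : ∑ μ, g.christoffel e μ μ κ x =
        (1 / 2) * ∑ μ, ∑ ν, g.invComp e ν μ x * partialDeriv κ (g.comp e μ ν) x := by
      -- In the contraction `Γ^μ_{μκ}` these two terms have opposite signs and cancel, because
      -- `g^{μσ}` is symmetric; only `∂_κ g` remains.
      have h3 : ∑ μ, ∑ σ, g.invComp e μ σ x * partialDeriv μ (g.comp e σ κ) x =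
          ∑ μ, ∑ σ, g.invComp e μ σ x * partialDeriv σ (g.comp e μ κ) x := by
        rw [Finset.sum_comm]
        exact Finset.sum_congr rfl fun μ _ => Finset.sum_congr rfl fun σ _ => by
          rw [invComp_symm]
      have h4 : ∑ μ, ∑ σ, g.invComp e μ σ x * partialDeriv κ (g.comp e σ μ) x =
          ∑ μ, ∑ ν, g.invComp e ν μ x * partialDeriv κ (g.comp e μ ν) x := by
        rw [Finset.sum_comm]
      simp only [LorentzianMetric.christoffel, ← Finset.mul_sum, mul_add, mul_sub,
        Finset.sum_add_distrib, Finset.sum_sub_distrib, h3, h4]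
      ring
    rw [Finset.sum_comm]
    simp only [← Finset.sum_mul, h2, apply_eq_sum (fderiv ℝ (g.comp e _ _) x) (fieldComp e V x),
      smul_eq_mul]
    simp only [Finset.mul_sum, Finset.sum_mul, partialDeriv]
    rw [Finset.sum_comm]
    refine Finset.sum_congr rfl fun μ _ => ?_
    rw [Finset.sum_comm]
    exact Finset.sum_congr rfl fun ν _ => Finset.sum_congr rfl fun κ _ => by ring
  have h5 : ∑ μ, g.covDeriv e V μ μ x = tr4 (fderiv ℝ (fieldComp e V) x) +
      ∑ μ, ∑ κ, g.christoffel e μ μ κ x * fieldComp e V x κ := by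
    simp only [LorentzianMetric.covDeriv, Finset.sum_add_distrib, partialDeriv_fieldComp he hV hx,
      tr4]
  rw [h5, h1, fderiv_volDensity vol he hx]
  ring

end ChartGeometry

/-! ### Pulling `vol (J, X, ·, ·)` back along maps from `ℝ³`. -/

section Pullback

variable {M : Type*} [TopologicalSpace M] [ChartedSpace E4 M] [IsManifold 𝓘(ℝ, E4) ∞ M]
  {g : LorentzianMetric M} {vol : g.VolumeForm}

/-- The flow of the `C¹` field `X` preserves the volume form and the field `J`, expressed in
charts. -/
structure PreservesVolumeAndField (vol : g.VolumeForm) (J X : Field M) : Prop where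
  contDiffAt : ∀ e ∈ IsManifold.maximalAtlas 𝓘(ℝ, E4) ∞ M, ∀ x ∈ e.target,
    ContDiffAt ℝ 1 (fieldComp e X) x
  comm : ∀ e ∈ IsManifold.maximalAtlas 𝓘(ℝ, E4) ∞ M, ∀ x ∈ e.target,
    fderiv ℝ (fieldComp e J) x (fieldComp e X x) = fderiv ℝ (fieldComp e X) x (fieldComp e J x)
  density : ∀ e ∈ IsManifold.maximalAtlas 𝓘(ℝ, E4) ∞ M, ∀ x ∈ e.target,
    fderiv ℝ (volDensity vol e) x (fieldComp e X x) +
      volDensity vol e x * tr4 (fderiv ℝ (fieldComp e X) x) = 0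

lemma IsSmoothField.of_le {m n : WithTop ℕ∞} {V : Field M} (hV : IsSmoothField n V) (h : m ≤ n) :
    IsSmoothField m V :=
  ContMDiff.of_le hV h

lemma PreservesVolumeAndField.of_isKilling {J ξ : Field M} (hJ : IsSmoothField 1 J)
    (hξ : IsSmoothField 1 ξ) (hK : g.IsKilling ξ)
    (hb : ∀ p, VectorField.mlieBracket 𝓘(ℝ, E4) ξ J p = 0) :
    PreservesVolumeAndField vol J ξ where
  contDiffAt _ he _ hx := contDiffAt_fieldComp he hξ hx
  comm _ he _ hx := fderiv_fieldComp_comm he hξ hJ hx (hb _)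
  density _ he _ hx := killing_volDensity vol he hξ hK hx

lemma fieldComp_add_smul (e : OpenPartialHomeomorph M E4) {X V W : Field M} {c : ℝ}
    (hX : ∀ p, X p = V p + c • W p) :
    fieldComp e X = fun x => fieldComp e V x + c • fieldComp e W x := by
  funext x
  simp only [fieldComp, hX]
  exact (map_add (mfderiv 𝓘(ℝ, E4) 𝓘(ℝ, E4) e (e.symm x)) _ _).trans
    (congrArg _ (map_smul (mfderiv 𝓘(ℝ, E4) 𝓘(ℝ, E4) e (e.symm x)) _ _))

/-- All conditions are linear in the field when the coefficient is constant; this carries them from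
`t` and `φ` to `X = t + Ω φ`. -/
lemma PreservesVolumeAndField.add_smul {J X V W : Field M} {c : ℝ}
    (hV : PreservesVolumeAndField vol J V) (hW : PreservesVolumeAndField vol J W)
    (hX : ∀ p, X p = V p + c • W p) : PreservesVolumeAndField vol J X := by
  have hd {e : OpenPartialHomeomorph M E4} (he : e ∈ IsManifold.maximalAtlas 𝓘(ℝ, E4) ∞ M) {x : E4}
      (hx : x ∈ e.target) : fderiv ℝ (fieldComp e X) x =
        fderiv ℝ (fieldComp e V) x + c • fderiv ℝ (fieldComp e W) x := by
    have h1 := (hV.contDiffAt e he x hx).differentiableAt (by simp)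
    have h2 := (hW.contDiffAt e he x hx).differentiableAt (by simp)
    rw [fieldComp_add_smul e hX]
    exact (h1.hasFDerivAt.add (h2.hasFDerivAt.const_smul c)).fderiv
  refine ⟨fun e he x hx => ?_, fun e he x hx => ?_, fun e he x hx => ?_⟩
  · rw [fieldComp_add_smul e hX]
    exact (hV.contDiffAt e he x hx).add ((hW.contDiffAt e he x hx).const_smul c)
  · rw [hd he hx, fieldComp_add_smul e hX]
    simp only [map_add, map_smul, hV.comm e he x hx, hW.comm e he x hx]
    rfl
  · have h1 := hV.density e he x hx
    have h2 := hW.density e he x hx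
    rw [hd he hx, fieldComp_add_smul e hX]
    simp only [map_add, map_smul, smul_eq_mul, tr4, add_apply, smul_apply, PiLp.add_apply,
      PiLp.smul_apply, Finset.sum_add_distrib, ← Finset.mul_sum] at h1 h2 ⊢
    linear_combination h1 + c * h2

variable {e : OpenPartialHomeomorph M E4}

lemma vol_eq_of_mem_source (he : e ∈ IsManifold.maximalAtlas 𝓘(ℝ, E4) ∞ M) {p : M}
    (hp : p ∈ e.source) (v : Fin 4 → TangentSpace 𝓘(ℝ, E4) p) :
    vol.toFun p v = volDensity vol e (e p) *
      det4 (mfderiv 𝓘(ℝ, E4) 𝓘(ℝ, E4) e p (v 0)) (mfderiv 𝓘(ℝ, E4) 𝓘(ℝ, E4) e p (v 1))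
        (mfderiv 𝓘(ℝ, E4) 𝓘(ℝ, E4) e p (v 2)) (mfderiv 𝓘(ℝ, E4) 𝓘(ℝ, E4) e p (v 3)) := by
  obtain ⟨x, hx, rfl⟩ : ∃ x ∈ e.target, e.symm x = p := ⟨e p, e.map_source hp, e.left_inv hp⟩
  rw [vol_eq vol he hx, e.right_inv hx]

lemma fieldComp_of_mem_source {p : M} (hp : p ∈ e.source) (V : Field M) :
    fieldComp e V (e p) = mfderiv 𝓘(ℝ, E4) 𝓘(ℝ, E4) e p (V p) := by
  rw [fieldComp, e.left_inv hp]

lemma fderiv_chart_comp {E : Type*} [NormedAddCommGroup E] [NormedSpace ℝ E]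
    (he : e ∈ IsManifold.maximalAtlas 𝓘(ℝ, E4) ∞ M) {Ψ : E → M} {q : E}
    (hΨ : MDifferentiableAt 𝓘(ℝ, E) 𝓘(ℝ, E4) Ψ q) (hq : Ψ q ∈ e.source) (a : E) :
    fderiv ℝ (fun z => e (Ψ z)) q a =
      mfderiv 𝓘(ℝ, E4) 𝓘(ℝ, E4) e (Ψ q) (mfderiv 𝓘(ℝ, E) 𝓘(ℝ, E4) Ψ q a) := by
  have h := mfderiv_comp q ((mdifferentiable_of_mem he).mdifferentiableAt hq) hΨ
  have h1 : mfderiv 𝓘(ℝ, E) 𝓘(ℝ, E4) (e ∘ Ψ) q = fderiv ℝ (fun z => e (Ψ z)) q :=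
    mfderiv_eq_fderiv
  rw [← h1, h]
  rfl

/-- The pullback of `vol (V, W, ·, ·)` along `Ψ`, in the chart `e`. -/
lemma vol_pullback_two {E : Type*} [NormedAddCommGroup E] [NormedSpace ℝ E]
    (he : e ∈ IsManifold.maximalAtlas 𝓘(ℝ, E4) ∞ M) {Ψ : E → M} {q : E}
    (hΨ : MDifferentiableAt 𝓘(ℝ, E) 𝓘(ℝ, E4) Ψ q) (hq : Ψ q ∈ e.source) (V W : Field M) (a b : E) :
    vol.toFun (Ψ q) ![V (Ψ q), W (Ψ q), mfderiv 𝓘(ℝ, E) 𝓘(ℝ, E4) Ψ q a,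
      mfderiv 𝓘(ℝ, E) 𝓘(ℝ, E4) Ψ q b] = volDensity vol e (e (Ψ q)) *
      det4 (fieldComp e V (e (Ψ q))) (fieldComp e W (e (Ψ q)))
        (fderiv ℝ (fun z => e (Ψ z)) q a) (fderiv ℝ (fun z => e (Ψ z)) q b) := by
  rw [vol_eq_of_mem_source he hq, fieldComp_of_mem_source hq, fieldComp_of_mem_source hq,
    fderiv_chart_comp he hΨ hq, fderiv_chart_comp he hΨ hq]
  rfl

/-- The pullback of `vol (V, ·, ·, ·)` along `Ψ`, in the chart `e`. -/
lemma vol_pullback_three {E : Type*} [NormedAddCommGroup E] [NormedSpace ℝ E]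
    (he : e ∈ IsManifold.maximalAtlas 𝓘(ℝ, E4) ∞ M) {Ψ : E → M} {q : E}
    (hΨ : MDifferentiableAt 𝓘(ℝ, E) 𝓘(ℝ, E4) Ψ q) (hq : Ψ q ∈ e.source) (V : Field M) (a b c : E) :
    vol.toFun (Ψ q) ![V (Ψ q), mfderiv 𝓘(ℝ, E) 𝓘(ℝ, E4) Ψ q a, mfderiv 𝓘(ℝ, E) 𝓘(ℝ, E4) Ψ q b,
      mfderiv 𝓘(ℝ, E) 𝓘(ℝ, E4) Ψ q c] = volDensity vol e (e (Ψ q)) *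
      det4 (fieldComp e V (e (Ψ q))) (fderiv ℝ (fun z => e (Ψ z)) q a)
        (fderiv ℝ (fun z => e (Ψ z)) q b) (fderiv ℝ (fun z => e (Ψ z)) q c) := by
  rw [vol_eq_of_mem_source he hq, fieldComp_of_mem_source hq,
    fderiv_chart_comp he hΨ hq, fderiv_chart_comp he hΨ hq, fderiv_chart_comp he hΨ hq]
  rfl

/-- The components of the pullback of the two-form `vol (J, X, ·, ·)` along `Ψ`, in cyclic order. -/
def pulledFlux (vol : g.VolumeForm) (J X : Field M) (Ψ : (Fin 3 → ℝ) → M) (i : Fin 3)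
    (q : Fin 3 → ℝ) : ℝ :=
  vol.toFun (Ψ q) ![J (Ψ q), X (Ψ q),
    mfderiv 𝓘(ℝ, Fin 3 → ℝ) 𝓘(ℝ, E4) Ψ q (Pi.single (i + 1) 1),
    mfderiv 𝓘(ℝ, Fin 3 → ℝ) 𝓘(ℝ, E4) Ψ q (Pi.single (i + 2) 1)]

variable {J X : Field M} {Ψ : (Fin 3 → ℝ) → M} {q : Fin 3 → ℝ}

lemma contDiffAt_chart_comp {n : ℕ} (he : e ∈ IsManifold.maximalAtlas 𝓘(ℝ, E4) ∞ M)
    (hΨ : ContMDiffAt 𝓘(ℝ, Fin 3 → ℝ) 𝓘(ℝ, E4) ∞ Ψ q) (hq : Ψ q ∈ e.source) :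
    ContDiffAt ℝ n (fun z => e (Ψ z)) q :=
  ((((contMDiffOn_of_mem_maximalAtlas he).contMDiffAt (e.open_source.mem_nhds hq)).comp q
    hΨ).of_le (WithTop.coe_le_coe.2 le_top)).contDiffAt

lemma pulledFlux_eventuallyEq (he : e ∈ IsManifold.maximalAtlas 𝓘(ℝ, E4) ∞ M)
    (hΨ : ContMDiffAt 𝓘(ℝ, Fin 3 → ℝ) 𝓘(ℝ, E4) ∞ Ψ q) (hq : Ψ q ∈ e.source) (i : Fin 3) :
    pulledFlux vol J X Ψ i =ᶠ[𝓝 q] fun z => volDensity vol e (e (Ψ z)) *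
      det4 (fieldComp e J (e (Ψ z))) (fieldComp e X (e (Ψ z)))
        (fderiv ℝ (fun z => e (Ψ z)) z (Pi.single (i + 1) 1))
        (fderiv ℝ (fun z => e (Ψ z)) z (Pi.single (i + 2) 1)) := by
  have h1 : ∀ᶠ z in 𝓝 q, ContMDiffAt 𝓘(ℝ, Fin 3 → ℝ) 𝓘(ℝ, E4) 1 Ψ z :=
    (contMDiffAt_iff_contMDiffAt_nhds (by simp)).1
      (hΨ.of_le (WithTop.coe_le_coe.2 le_top))
  filter_upwards [h1, hΨ.continuousAt.preimage_mem_nhds (e.open_source.mem_nhds hq)] with z hz hz'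
  exact vol_pullback_two he (hz.mdifferentiableAt (by simp)) hz' J X _ _

/-- No derivative is lost: `J` and `X` enter undifferentiated, and only the smooth map `Ψ` is
differentiated. The divergence theorem can therefore be applied to a `J` that is merely `C¹`. -/
lemma contDiffAt_pulledFlux (hJ : IsSmoothField 1 J) (hX : PreservesVolumeAndField vol J X)
    (hΨ : ContMDiffAt 𝓘(ℝ, Fin 3 → ℝ) 𝓘(ℝ, E4) ∞ Ψ q) (i : Fin 3) :
    ContDiffAt ℝ 1 (pulledFlux vol J X Ψ i) q := by
  have he := IsManifold.chart_mem_maximalAtlas (I := 𝓘(ℝ, E4)) (n := ∞) (Ψ q)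
  have hq := mem_chart_source E4 (Ψ q)
  have hx := (chartAt E4 (Ψ q)).map_source hq
  have hy : ContDiffAt ℝ 2 _ q := contDiffAt_chart_comp (n := 2) he hΨ hq
  have hy1 := hy.of_le (m := 1) (by norm_num)
  have hdy := hy.fderiv_right (m := 1) (by norm_num)
  refine ContDiffAt.congr_of_eventuallyEq ?_ (pulledFlux_eventuallyEq he hΨ hq i)
  refine ContDiffAt.mul ?_ (contDiffAt_det4 ?_ ?_ ?_ ?_)
  · exact ((contDiffAt_volDensity vol he hx).of_le (WithTop.coe_le_coe.2 le_top)).comp q hy1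
  · exact (contDiffAt_fieldComp he hJ hx).comp q hy1
  · exact (hX.contDiffAt _ he _ hx).comp q hy1
  · exact hdy.clm_apply contDiffAt_const
  · exact hdy.clm_apply contDiffAt_const

lemma sum_fderiv_pulledFlux (hJ : IsSmoothField 1 J) (hX : PreservesVolumeAndField vol J X)
    {s : ℝ} (hs : g.divergence J (Ψ q) = - s)
    (hΨ : ContMDiffAt 𝓘(ℝ, Fin 3 → ℝ) 𝓘(ℝ, E4) ∞ Ψ q) :
    ∑ i, fderiv ℝ (pulledFlux vol J X Ψ i) q (Pi.single i 1) =
      s * vol.toFun (Ψ q) ![X (Ψ q),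
        mfderiv 𝓘(ℝ, Fin 3 → ℝ) 𝓘(ℝ, E4) Ψ q (Pi.single 0 1),
        mfderiv 𝓘(ℝ, Fin 3 → ℝ) 𝓘(ℝ, E4) Ψ q (Pi.single 1 1),
        mfderiv 𝓘(ℝ, Fin 3 → ℝ) 𝓘(ℝ, E4) Ψ q (Pi.single 2 1)] := by
  have he := IsManifold.chart_mem_maximalAtlas (I := 𝓘(ℝ, E4)) (n := ∞) (Ψ q)
  have hq := mem_chart_source E4 (Ψ q)
  have hx := (chartAt E4 (Ψ q)).map_source hq
  have hy : ContDiffAt ℝ 2 _ q := contDiffAt_chart_comp (n := 2) he hΨ hq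
  refine (Finset.sum_congr rfl fun i _ => DFunLike.congr_fun
    (pulledFlux_eventuallyEq he hΨ hq i).fderiv_eq (Pi.single i 1)).trans ?_
  rw [vol_pullback_three he (hΨ.mdifferentiableAt (by simp)) hq]
  refine sum_fderiv_det4_comp hy ((contDiffAt_volDensity vol he hx).differentiableAt (by simp))
    ((contDiffAt_fieldComp he hJ hx).differentiableAt (by simp))
    ((hX.contDiffAt _ he _ hx).differentiableAt (by simp)) (hX.comm _ he _ hx)
    (hX.density _ he _ hx) ?_
  rw [divergence_volDensity vol he hJ hx]
  -- The computation uses the preferred chart at `Ψ q`, the one in which `divergence` is defined, so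
  -- no independence of the chart is needed.
  have h : ∑ μ, g.covDeriv (chartAt E4 (Ψ q)) J μ μ (chartAt E4 (Ψ q) (Ψ q)) = - s := hs
  rw [h]
  ring

end Pullback

/-! ### Spherical coordinates on `ℝ³`. -/

/-- Spherical coordinates `(r, θ, φ)` on `ℝ³`. -/
def sph (q : Fin 3 → ℝ) : E3 :=
  !₂[q 0 * Real.sin (q 1) * Real.cos (q 2), q 0 * Real.sin (q 1) * Real.sin (q 2),
    q 0 * Real.cos (q 1)]

lemma contDiff_sph {n : WithTop ℕ∞} : ContDiff ℝ n sph := by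
  rw [contDiff_piLp]
  intro i
  fin_cases i <;> simp [sph] <;> fun_prop

lemma norm_sph (q : Fin 3 → ℝ) : ‖sph q‖ = |q 0| := by
  rw [EuclideanSpace.norm_eq, ← Real.sqrt_sq_eq_abs]
  congr 1
  simp only [sph, Fin.sum_univ_three, Real.norm_eq_abs, sq_abs]
  simp
  linear_combination (q 0 ^ 2 * Real.sin (q 1) ^ 2) * Real.sin_sq_add_cos_sq (q 2) +
    q 0 ^ 2 * Real.sin_sq_add_cos_sq (q 1)

lemma fderiv_sph (q v : Fin 3 → ℝ) : fderiv ℝ sph q v =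
    !₂[v 0 * Real.sin (q 1) * Real.cos (q 2) + q 0 * Real.cos (q 1) * v 1 * Real.cos (q 2)
        - q 0 * Real.sin (q 1) * Real.sin (q 2) * v 2,
      v 0 * Real.sin (q 1) * Real.sin (q 2) + q 0 * Real.cos (q 1) * v 1 * Real.sin (q 2)
        + q 0 * Real.sin (q 1) * Real.cos (q 2) * v 2,
      v 0 * Real.cos (q 1) - q 0 * Real.sin (q 1) * v 1] := by
  have hd : HasFDerivAt sph (fderiv ℝ sph q) q :=
    ((contDiff_sph (n := 1)).differentiable (by simp) q).hasFDerivAt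
  have hp (i : Fin 3) : HasFDerivAt (fun z => sph z i)
      ((EuclideanSpace.proj i : E3 →L[ℝ] ℝ).comp (fderiv ℝ sph q)) q :=
    ((EuclideanSpace.proj i : E3 →L[ℝ] ℝ).hasFDerivAt).comp q hd
  have h (i : Fin 3) : HasFDerivAt (fun z : Fin 3 → ℝ => z i)
      (ContinuousLinearMap.proj i : (Fin 3 → ℝ) →L[ℝ] ℝ) q :=
    (ContinuousLinearMap.proj i : (Fin 3 → ℝ) →L[ℝ] ℝ).hasFDerivAt
  ext i
  fin_cases i
  · have := DFunLike.congr_fun ((hp 0).unique (((h 0).mul (h 1).sin).mul (h 2).cos)) v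
    refine this.trans ?_
    simp
    ring
  · have := DFunLike.congr_fun ((hp 1).unique (((h 0).mul (h 1).sin).mul (h 2).sin)) v
    refine this.trans ?_
    simp
    ring
  · have := DFunLike.congr_fun ((hp 2).unique ((h 0).mul (h 1).cos)) v
    refine this.trans ?_
    simp
    ring

/-! ### Stokes' theorem on a box of spherical coordinates. -/

section Box

variable {M : Type*} [TopologicalSpace M] [ChartedSpace E4 M] [IsManifold 𝓘(ℝ, E4) ∞ M]
  {g : LorentzianMetric M} {vol : g.VolumeForm} {t φ : Field M} {H : Set M}
  {c : AsymptoticChart g vol t φ} (N : HorizonToInfinity H c)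

/-- The hypersurface parametrized by spherical coordinates on `{|y| ≥ 1}`. -/
def HorizonToInfinity.sphParam (q : Fin 3 → ℝ) : M := N.param (sph q)

lemma sph_mem_exteriorDomain {q : Fin 3 → ℝ} (hq : 1 ≤ q 0) : sph q ∈ exteriorDomain := by
  change 1 ≤ ‖sph q‖
  rw [norm_sph]
  exact hq.trans (le_abs_self _)

lemma contMDiffAt_sphParam {q : Fin 3 → ℝ} (hq : 1 ≤ q 0) :
    ContMDiffAt 𝓘(ℝ, Fin 3 → ℝ) 𝓘(ℝ, E4) ∞ N.sphParam q :=
  (N.smooth _ (sph_mem_exteriorDomain hq)).comp q contDiff_sph.contMDiff.contMDiffAt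

lemma mfderiv_sphParam {q : Fin 3 → ℝ} (hq : 1 ≤ q 0) (v : Fin 3 → ℝ) :
    mfderiv 𝓘(ℝ, Fin 3 → ℝ) 𝓘(ℝ, E4) N.sphParam q v =
      mfderiv 𝓘(ℝ, E3) 𝓘(ℝ, E4) N.param (sph q) (fderiv ℝ sph q v) := by
  have h := mfderiv_comp q ((N.smooth _ (sph_mem_exteriorDomain hq)).mdifferentiableAt (by simp))
    ((contDiff_sph (n := 1)).contMDiff.contMDiffAt.mdifferentiableAt (by simp))
  rw [mfderiv_eq_fderiv] at h
  exact DFunLike.congr_fun h v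

lemma pulledFlux_sphParam (J X : Field M) {q : Fin 3 → ℝ} (hq : 1 ≤ q 0) (i : Fin 3) :
    pulledFlux vol J X N.sphParam i q = vol.toFun (N.param (sph q)) ![J (N.param (sph q)),
      X (N.param (sph q)),
      mfderiv 𝓘(ℝ, E3) 𝓘(ℝ, E4) N.param (sph q) (fderiv ℝ sph q (Pi.single (i + 1) 1)),
      mfderiv 𝓘(ℝ, E3) 𝓘(ℝ, E4) N.param (sph q) (fderiv ℝ sph q (Pi.single (i + 2) 1))] := by
  rw [pulledFlux, mfderiv_sphParam N hq, mfderiv_sphParam N hq]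
  rfl

/-- The coordinate vector `∂_φ` vanishes on the polar axis, so the faces `θ = 0` and `θ = π` carry
no flux. -/
lemma pulledFlux_one_eq_zero (J X : Field M) {q : Fin 3 → ℝ} (hq : 1 ≤ q 0)
    (h : Real.sin (q 1) = 0) : pulledFlux vol J X N.sphParam 1 q = 0 := by
  rw [pulledFlux_sphParam N J X hq]
  refine (vol.toFun _).map_coord_zero 2 ?_
  have h0 : fderiv ℝ sph q (Pi.single ((1 : Fin 3) + 1) 1) = 0 := by
    rw [fderiv_sph, h]
    ext i
    fin_cases i <;> simp [show (1 : Fin 3) + 1 = 2 from rfl]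
  exact (congrArg (mfderiv 𝓘(ℝ, E3) 𝓘(ℝ, E4) N.param (sph q)) h0).trans (map_zero _)

/-- The faces `φ = 0` and `φ = 2π` have the same image, so their fluxes cancel. -/
lemma pulledFlux_two_periodic (J X : Field M) {q q' : Fin 3 → ℝ} (hq : 1 ≤ q 0) (h0 : q' 0 = q 0)
    (h1 : q' 1 = q 1) (h2 : q' 2 = q 2 + 2 * Real.pi) :
    pulledFlux vol J X N.sphParam 2 q' = pulledFlux vol J X N.sphParam 2 q := by
  have hs : sph q' = sph q := by simp only [sph, h0, h1, h2, Real.cos_add_two_pi,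
    Real.sin_add_two_pi]
  have hd (v) : fderiv ℝ sph q' v = fderiv ℝ sph q v := by
    simp only [fderiv_sph, h0, h1, h2, Real.cos_add_two_pi, Real.sin_add_two_pi]
  rw [pulledFlux_sphParam N J X hq, pulledFlux_sphParam N J X (h0 ▸ hq), hd, hd, hs]

/-- The flux form vanishes along the boundary of the hypersurface, where all four of its arguments
are orthogonal to `X`. -/
lemma pulledFlux_boundary {J X : Field M} (hH : g.IsNullHypersurfaceGeneratedBy H X)
    (hXJ : ∀ p, g.toFun p (X p) (J p) = 0) {q : Fin 3 → ℝ} (hq : q 0 = 1) :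
    pulledFlux vol J X N.sphParam 0 q = 0 := by
  have hmem {z : Fin 3 → ℝ} (hz : z 0 = 1) : N.sphParam z ∈ H :=
    N.boundary _ (by rw [norm_sph, hz, abs_one])
  obtain ⟨k, -, hkk, ⟨a, ha⟩, f, hf, hfH, hdf⟩ := hH _ (hmem hq)
  have hΨ := contMDiffAt_sphParam N hq.ge
  -- Coordinate lines in the directions `θ` and `φ` stay on `|y| = 1`, hence in `H`, where the
  -- defining function `f` vanishes; its derivative along them is `g(k, ·)`.
  have htan (i : Fin 3) (hi : i ≠ 0) : g.toFun (N.sphParam q) k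
      (mfderiv 𝓘(ℝ, Fin 3 → ℝ) 𝓘(ℝ, E4) N.sphParam q (Pi.single i 1)) = 0 := by
    rw [← hdf]
    have hcomp := mfderiv_comp q (hf.mdifferentiableAt (by simp)) (hΨ.mdifferentiableAt (by simp))
    have hdiff : DifferentiableAt ℝ (f ∘ N.sphParam) q :=
      ((hf.comp q hΨ).mdifferentiableAt (by simp)).differentiableAt
    rw [mfderiv_eq_fderiv] at hcomp
    refine (DFunLike.congr_fun hcomp (Pi.single i 1)).symm.trans ?_
    refine hdiff.lineDeriv_eq_fderiv.symm.trans ?_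
    have hcont : Tendsto (fun s : ℝ => N.sphParam (q + s • Pi.single i 1)) (𝓝 0)
        (𝓝 (N.sphParam q)) := by
      have h1 : Tendsto (fun s : ℝ => q + s • (Pi.single i 1 : Fin 3 → ℝ)) (𝓝 0) (𝓝 q) := by
        have : Continuous fun s : ℝ => q + s • (Pi.single i 1 : Fin 3 → ℝ) := by fun_prop
        simpa using this.tendsto 0
      exact hΨ.continuousAt.tendsto.comp h1
    have hzero : (fun s : ℝ => (f ∘ N.sphParam) (q + s • Pi.single i 1)) =ᶠ[𝓝 0] fun _ => 0 := by
      filter_upwards [hcont.eventually hfH] with s hs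
      exact hs.1 (hmem (by simp [hq, hi.symm]))
    exact hzero.deriv_eq.trans (deriv_const _ _)
  have hX (w) (hw : g.toFun (N.sphParam q) k w = 0) :
      g.toFun (N.sphParam q) (X (N.sphParam q)) w = 0 := by
    rw [ha, map_smul, LinearMap.smul_apply, hw, smul_zero]
  -- The square of `vol` is minus a Gram determinant, and the row of `X` (index 1, after `J`) is
  -- zero. This covers `X = 0` without a case distinction.
  refine pow_eq_zero_iff two_ne_zero |>.1 ((vol.sq _ _).trans ?_)
  rw [neg_eq_zero]
  refine Matrix.det_eq_zero_of_row_eq_zero 1 fun j => ?_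
  fin_cases j
  · exact hXJ _
  · refine hX _ ((congrArg (g.toFun (N.sphParam q) k) ha).trans ?_)
    rw [map_smul, hkk, smul_zero]
  · exact hX _ (htan 1 (by decide))
  · exact hX _ (htan 2 (by decide))

/-- The Stokes theorem on `{1 ≤ |y| ≤ R}` in spherical coordinates: the flux through the horizon
vanishes. -/
lemma integral_box {J X : Field M} (hJ : IsSmoothField 1 J)
    (hX : PreservesVolumeAndField vol J X) (hH : g.IsNullHypersurfaceGeneratedBy H X)
    (hXJ : ∀ p, g.toFun p (X p) (J p) = 0) {s : M → ℝ} (hs : ∀ p, g.divergence J p = - s p)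
    {R : ℝ} (hR : 1 ≤ R) :
    ∫ q in Set.Icc (![1, 0, 0] : Fin 3 → ℝ) ![R, Real.pi, 2 * Real.pi],
      s (N.sphParam q) * vol.toFun (N.sphParam q) ![X (N.sphParam q),
        mfderiv 𝓘(ℝ, Fin 3 → ℝ) 𝓘(ℝ, E4) N.sphParam q (Pi.single 0 1),
        mfderiv 𝓘(ℝ, Fin 3 → ℝ) 𝓘(ℝ, E4) N.sphParam q (Pi.single 1 1),
        mfderiv 𝓘(ℝ, Fin 3 → ℝ) 𝓘(ℝ, E4) N.sphParam q (Pi.single 2 1)] =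
    ∫ x in Set.Icc (![0, 0] : Fin 2 → ℝ) ![Real.pi, 2 * Real.pi],
      pulledFlux vol J X N.sphParam 0 ![R, x 0, x 1] := by
  have hle : (![1, 0, 0] : Fin 3 → ℝ) ≤ ![R, Real.pi, 2 * Real.pi] := by
    intro i
    fin_cases i
    exacts [hR, Real.pi_pos.le, Real.two_pi_pos.le]
  have hbox {q : Fin 3 → ℝ}
      (hq : q ∈ Set.Icc (![1, 0, 0] : Fin 3 → ℝ) ![R, Real.pi, 2 * Real.pi]) : 1 ≤ q 0 := hq.1 0
  have hC1 {q : Fin 3 → ℝ} (hq : 1 ≤ q 0) (i : Fin 3) :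
      ContDiffAt ℝ 1 (pulledFlux vol J X N.sphParam i) q :=
    contDiffAt_pulledFlux hJ hX (contMDiffAt_sphParam N hq) i
  have hdiv := integral_divergence_of_hasFDerivAt_off_countable (n := 2) _ _ hle
    (fun q i => pulledFlux vol J X N.sphParam i q)
    (fun q => ContinuousLinearMap.pi fun i => fderiv ℝ (pulledFlux vol J X N.sphParam i) q)
    ∅ Set.countable_empty
    (continuousOn_pi.2 fun i q hq => (hC1 (hbox hq) i).continuousAt.continuousWithinAt)
    (fun q hq => hasFDerivAt_pi.2 fun i => ((hC1 ((hq.1 0 trivial).1.le) i).differentiableAt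
      (by simp)).hasFDerivAt)
    (by
      refine ContinuousOn.integrableOn_compact isCompact_Icc ?_
      refine continuousOn_finsetSum _ fun i _ q hq => ContinuousAt.continuousWithinAt ?_
      exact ((hC1 (hbox hq) i).fderiv_right (m := 0) (by simp)).continuousAt.clm_apply
        continuousAt_const)
  refine (setIntegral_congr_fun measurableSet_Icc fun q hq => ?_).trans (hdiv.trans ?_)
  · exact (sum_fderiv_pulledFlux hJ hX (hs _) (contMDiffAt_sphParam N (hbox hq))).symm
  · rw [Fin.sum_univ_three]
    -- Of the six faces only `r = R` survives: the horizon face and the polar faces vanish, and the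
    -- two faces in `φ` cancel.
    have e0 : ∫ x in Set.Icc ((![1, 0, 0] : Fin 3 → ℝ) ∘ (0 : Fin 3).succAbove)
        (![R, Real.pi, 2 * Real.pi] ∘ (0 : Fin 3).succAbove),
        pulledFlux vol J X N.sphParam 0
          ((0 : Fin 3).insertNth ((![1, 0, 0] : Fin 3 → ℝ) 0) x) = 0 :=
      setIntegral_eq_zero_of_forall_eq_zero fun x _ => pulledFlux_boundary N hH hXJ (by simp)
    have e1 (z : ℝ) (hz : Real.sin z = 0) :
        ∫ x in Set.Icc ((![1, 0, 0] : Fin 3 → ℝ) ∘ (1 : Fin 3).succAbove)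
        (![R, Real.pi, 2 * Real.pi] ∘ (1 : Fin 3).succAbove),
        pulledFlux vol J X N.sphParam 1 ((1 : Fin 3).insertNth z x) = 0 :=
      setIntegral_eq_zero_of_forall_eq_zero fun x hx =>
        pulledFlux_one_eq_zero N J X (hx.1 0) (by simpa using hz)
    have e2 : ∫ x in Set.Icc ((![1, 0, 0] : Fin 3 → ℝ) ∘ (2 : Fin 3).succAbove)
        (![R, Real.pi, 2 * Real.pi] ∘ (2 : Fin 3).succAbove),
        pulledFlux vol J X N.sphParam 2
          ((2 : Fin 3).insertNth ((![R, Real.pi, 2 * Real.pi] : Fin 3 → ℝ) 2) x) =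
        ∫ x in Set.Icc ((![1, 0, 0] : Fin 3 → ℝ) ∘ (2 : Fin 3).succAbove)
        (![R, Real.pi, 2 * Real.pi] ∘ (2 : Fin 3).succAbove),
        pulledFlux vol J X N.sphParam 2
          ((2 : Fin 3).insertNth ((![1, 0, 0] : Fin 3 → ℝ) 2) x) := by
      refine setIntegral_congr_fun measurableSet_Icc fun x hx =>
        pulledFlux_two_periodic N J X (hx.1 0) rfl rfl ?_
      simp
    have e3 (z : ℝ) : ∫ x in Set.Icc ((![1, 0, 0] : Fin 3 → ℝ) ∘ (0 : Fin 3).succAbove)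
        (![R, Real.pi, 2 * Real.pi] ∘ (0 : Fin 3).succAbove),
        pulledFlux vol J X N.sphParam 0 ((0 : Fin 3).insertNth z x) =
        ∫ x in Set.Icc (![0, 0] : Fin 2 → ℝ) ![Real.pi, 2 * Real.pi],
          pulledFlux vol J X N.sphParam 0 ![z, x 0, x 1] := by
      have h1 : (![1, 0, 0] : Fin 3 → ℝ) ∘ (0 : Fin 3).succAbove = ![0, 0] := by
        funext i; fin_cases i <;> rfl
      have h2 : (![R, Real.pi, 2 * Real.pi] : Fin 3 → ℝ) ∘ (0 : Fin 3).succAbove =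
          ![Real.pi, 2 * Real.pi] := by
        funext i; fin_cases i <;> rfl
      rw [h1, h2]
      refine setIntegral_congr_fun measurableSet_Icc fun x _ => ?_
      congr 1
      funext i; fin_cases i <;> rfl
    refine (congrArg₂ _ (congrArg₂ _ (congrArg₂ _ (e3 R) e0)
      (congrArg₂ _ (e1 _ Real.sin_pi) (e1 _ Real.sin_zero))) (sub_eq_zero.2 e2)).trans ?_
    simp

end Box

/-! ### Integration over shells in spherical coordinates. -/

/-- The coordinate box `1 < r < R`, `0 < θ < π`, `0 < φ < 2π`. -/
def sphBox (R : ℝ) : Set (Fin 3 → ℝ) :=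
  Set.univ.pi fun i => Set.Ioo ((![1, 0, 0] : Fin 3 → ℝ) i)
    ((![R, Real.pi, 2 * Real.pi] : Fin 3 → ℝ) i)

lemma mem_sphBox {R : ℝ} {q : Fin 3 → ℝ} : q ∈ sphBox R ↔
    (1 < q 0 ∧ q 0 < R) ∧ (0 < q 1 ∧ q 1 < Real.pi) ∧ (0 < q 2 ∧ q 2 < 2 * Real.pi) := by
  simp [sphBox, Set.mem_pi, Fin.forall_fin_succ]

lemma measurableSet_sphBox (R : ℝ) : MeasurableSet (sphBox R) :=
  MeasurableSet.univ_pi fun _ => measurableSet_Ioo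

/-- The shell `1 ≤ |y| ≤ R`. -/
def shell (R : ℝ) : Set E3 := {y | 1 ≤ ‖y‖ ∧ ‖y‖ ≤ R}

lemma measurableSet_shell (R : ℝ) : MeasurableSet (shell R) :=
  (isClosed_le continuous_const continuous_norm).measurableSet.inter
    (isClosed_le continuous_norm continuous_const).measurableSet

lemma injOn_sph (R : ℝ) : Set.InjOn sph (sphBox R) := by
  intro p hp q hq h
  rw [mem_sphBox] at hp hq
  obtain ⟨⟨hp0, -⟩, ⟨hp1, hp1'⟩, hp2, hp2'⟩ := hp
  obtain ⟨⟨hq0, -⟩, ⟨hq1, hq1'⟩, hq2, hq2'⟩ := hq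
  have e0 : p 0 = q 0 := by
    have := congrArg norm h
    rwa [norm_sph, norm_sph, abs_of_pos (by linarith), abs_of_pos (by linarith)] at this
  have hr : q 0 ≠ 0 := by linarith
  have c0 : sph p 0 = sph q 0 := by rw [h]
  have c1 : sph p 1 = sph q 1 := by rw [h]
  have c2 : sph p 2 = sph q 2 := by rw [h]
  simp only [sph] at c0 c1 c2
  simp [e0, hr] at c0 c1 c2
  have e1 : p 1 = q 1 := Real.injOn_cos ⟨hp1.le, hp1'.le⟩ ⟨hq1.le, hq1'.le⟩ c2
  have hs : Real.sin (q 1) ≠ 0 := (Real.sin_pos_of_pos_of_lt_pi hq1 hq1').ne'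
  rw [e1, mul_assoc, mul_assoc] at c0 c1
  have d0 := mul_left_cancel₀ hs (mul_left_cancel₀ hr c0)
  have d1 := mul_left_cancel₀ hs (mul_left_cancel₀ hr c1)
  -- The azimuths agree up to `2πk`, and both lie in an open interval of length `2π`, which forces
  -- `k = 0`.
  obtain ⟨k, hk⟩ := Real.Angle.angle_eq_iff_two_pi_dvd_sub.1 (Real.Angle.cos_sin_inj d0 d1)
  have hπ := Real.pi_pos
  have k1 : (k : ℝ) < 1 := by
    by_contra! hc
    nlinarith
  have k2 : (-1 : ℝ) < k := by
    by_contra! hc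
    nlinarith
  have k0 : k = 0 := by
    have : k < 1 := by exact_mod_cast k1
    have : -1 < k := by exact_mod_cast k2
    omega
  have e2 : p 2 = q 2 := by
    rw [k0] at hk
    simp at hk
    linarith
  funext i
  fin_cases i
  exacts [e0, e1, e2]

/-- The complex argument, moved from `(-π, π]` to `(0, 2π)`; `b ≠ 0` excludes the argument `0`. -/
lemma exists_angle {a b : ℝ} (hb : b ≠ 0) :
    ∃ ϕ, 0 < ϕ ∧ ϕ < 2 * Real.pi ∧ a = √(a ^ 2 + b ^ 2) * Real.cos ϕ ∧
      b = √(a ^ 2 + b ^ 2) * Real.sin ϕ := by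
  have hn : ‖(⟨a, b⟩ : ℂ)‖ = √(a ^ 2 + b ^ 2) := by
    rw [Complex.norm_def, Complex.normSq_mk]
    ring_nf
  have h1 := Complex.norm_mul_cos_arg ⟨a, b⟩
  have h2 := Complex.norm_mul_sin_arg ⟨a, b⟩
  rw [hn] at h1 h2
  have h3 := Complex.neg_pi_lt_arg ⟨a, b⟩
  have h4 := Complex.arg_le_pi ⟨a, b⟩
  have hπ := Real.pi_pos
  rcases lt_trichotomy (Complex.arg ⟨a, b⟩) 0 with h | h | h
  · refine ⟨Complex.arg ⟨a, b⟩ + 2 * Real.pi, by linarith, by linarith, ?_, ?_⟩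
    · rw [Real.cos_add_two_pi, h1]
    · rw [Real.sin_add_two_pi, h2]
  · rw [h] at h2
    simp at h2
    exact absurd h2.symm hb
  · exact ⟨_, h, by linarith, h1.symm, h2.symm⟩

lemma norm_sq_E3 (y : E3) : ‖y‖ ^ 2 = y 0 ^ 2 + y 1 ^ 2 + y 2 ^ 2 := by
  rw [EuclideanSpace.norm_sq_eq]
  simp [Fin.sum_univ_three]

/-- The condition `y 1 ≠ 0` removes both the half-plane `φ = 0` and the polar axis, so all three
coordinates fall in open intervals. -/
lemma mem_image_sph {R : ℝ} {y : E3} (h1 : 1 < ‖y‖) (hR : ‖y‖ < R) (hy : y 1 ≠ 0) :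
    y ∈ sph '' sphBox R := by
  have hr : 0 < ‖y‖ := by linarith
  have hn := norm_sq_E3 y
  have hy2 : 0 < y 1 ^ 2 := by positivity
  have hlt : (y 2 / ‖y‖) ^ 2 < 1 := by
    rw [div_pow, div_lt_one (by positivity)]
    nlinarith [sq_nonneg (y 0)]
  have hlt' := abs_lt.1 ((sq_lt_one_iff_abs_lt_one _).1 hlt)
  obtain ⟨ϕ, hϕ0, hϕ1, hc, hs⟩ := exists_angle (a := y 0) hy
  have hsin : ‖y‖ * Real.sin (Real.arccos (y 2 / ‖y‖)) = √(y 0 ^ 2 + y 1 ^ 2) := by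
    rw [Real.sin_arccos, eq_comm, Real.sqrt_eq_iff_mul_self_eq (by positivity) (by positivity),
      mul_mul_mul_comm, Real.mul_self_sqrt (by linarith)]
    field_simp
    linarith
  have hcos : Real.cos (Real.arccos (y 2 / ‖y‖)) = y 2 / ‖y‖ :=
    Real.cos_arccos hlt'.1.le hlt'.2.le
  refine ⟨![‖y‖, Real.arccos (y 2 / ‖y‖), ϕ], mem_sphBox.2 ⟨⟨h1, hR⟩, ⟨?_, ?_⟩, hϕ0, hϕ1⟩, ?_⟩
  · exact Real.arccos_pos.2 hlt'.2
  · refine lt_of_le_of_ne (Real.arccos_le_pi _) fun h => ?_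
    exact absurd (Real.arccos_eq_pi.1 h) (not_le.2 hlt'.1)
  · ext i
    fin_cases i
    · simpa [sph, hsin] using hc.symm
    · simpa [sph, hsin] using hs.symm
    · simp [sph, hcos]
      field_simp

/-- The missing points lie in the plane `y 1 = 0` or on the two bounding spheres, which are null
sets. -/
lemma image_sph_ae_eq (R : ℝ) : sph '' sphBox R =ᵐ[volume] shell R := by
  have hplane : volume {y : E3 | y 1 = 0} = 0 := by
    have h := Measure.addHaar_submodule (volume : Measure E3)
      (LinearMap.ker (EuclideanSpace.proj 1 : E3 →L[ℝ] ℝ).toLinearMap) (by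
        intro h
        have : basisVec3 1 ∈ LinearMap.ker (EuclideanSpace.proj 1 : E3 →L[ℝ] ℝ).toLinearMap := by
          rw [h]; trivial
        simp [basisVec3] at this)
    exact h
  have h1 := Measure.addHaar_sphere (volume : Measure E3) 0 1
  have hR := Measure.addHaar_sphere (volume : Measure E3) 0 R
  rw [ae_eq_set]
  constructor
  · rw [Set.sdiff_eq_empty.2, measure_empty]
    rintro _ ⟨q, hq, rfl⟩
    rw [mem_sphBox] at hq
    have h0 : ‖sph q‖ = q 0 := by rw [norm_sph, abs_of_pos (by linarith)]
    exact ⟨by rw [h0]; exact hq.1.1.le, by rw [h0]; exact hq.1.2.le⟩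
  · refine measure_mono_null (t := {y : E3 | y 1 = 0} ∪ (Metric.sphere 0 1 ∪ Metric.sphere 0 R)) ?_
      (measure_union_null hplane (measure_union_null h1 hR))
    rintro y ⟨⟨hy1, hyR⟩, hy⟩
    by_contra hc
    simp only [Set.mem_union, Set.mem_ofPred_eq, mem_sphere_zero_iff_norm, not_or] at hc
    exact hy (mem_image_sph (lt_of_le_of_ne hy1 (Ne.symm hc.2.1)) (lt_of_le_of_ne hyR hc.2.2) hc.1)

/-- Integration over a shell in spherical coordinates. -/
lemma integral_shell (R : ℝ) (F : E3 → ℝ) :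
    ∫ y in shell R, F y = ∫ q in Set.Icc (![1, 0, 0] : Fin 3 → ℝ) ![R, Real.pi, 2 * Real.pi],
      F (sph q) * (q 0 ^ 2 * Real.sin (q 1)) := by
  have hbox : sphBox R =ᵐ[volume] Set.Icc (![1, 0, 0] : Fin 3 → ℝ) ![R, Real.pi, 2 * Real.pi] :=
    Measure.univ_pi_Ioo_ae_eq_Icc
  -- On the open box the coordinate map is injective with positive Jacobian; passing to it changes
  -- neither integral.
  rw [← setIntegral_congr_set (image_sph_ae_eq R), ← setIntegral_congr_set hbox]
  have hmp := PiLp.volume_preserving_toLp (Fin 3)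
  rw [← hmp.setIntegral_preimage_emb (MeasurableEquiv.toLp 2 (Fin 3 → ℝ)).measurableEmbedding]
  have himg : (WithLp.toLp 2) ⁻¹' (sph '' sphBox R) = (fun q => (sph q).ofLp) '' sphBox R := by
    ext x
    constructor
    · rintro ⟨q, hq, h⟩
      exact ⟨q, hq, congrArg WithLp.ofLp h⟩
    · rintro ⟨q, hq, rfl⟩
      exact ⟨q, hq, rfl⟩
  let f' (q : Fin 3 → ℝ) : (Fin 3 → ℝ) →L[ℝ] (Fin 3 → ℝ) :=
    (EuclideanSpace.equiv (Fin 3) ℝ : E3 →L[ℝ] (Fin 3 → ℝ)).comp (fderiv ℝ sph q)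
  have hf' (q : Fin 3 → ℝ) : HasFDerivAt (fun q => (sph q).ofLp) (f' q) q :=
    (EuclideanSpace.equiv (Fin 3) ℝ : E3 →L[ℝ] (Fin 3 → ℝ)).hasFDerivAt.comp q
      ((contDiff_sph (n := 1)).differentiable (by simp) q).hasFDerivAt
  have hdet (q : Fin 3 → ℝ) : (f' q).det = q 0 ^ 2 * Real.sin (q 1) := by
    have h (i j : Fin 3) : LinearMap.toMatrix' (f' q : (Fin 3 → ℝ) →ₗ[ℝ] (Fin 3 → ℝ)) i j =
        fderiv ℝ sph q (Pi.single j 1) i := by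
      rw [LinearMap.toMatrix'_apply]
      rfl
    rw [ContinuousLinearMap.det, ← LinearMap.det_toMatrix', Matrix.det_fin_three]
    simp only [h, fderiv_sph]
    simp
    have h1 := Real.sin_sq_add_cos_sq (q 1)
    have h2 := Real.sin_sq_add_cos_sq (q 2)
    linear_combination (q 0 ^ 2 * Real.sin (q 1) *
      (Real.sin (q 1) ^ 2 + Real.cos (q 1) ^ 2)) * h2 + (q 0 ^ 2 * Real.sin (q 1)) * h1
  rw [himg, integral_image_eq_integral_abs_det_fderiv_smul volume (measurableSet_sphBox R)
    (fun q _ => (hf' q).hasFDerivWithinAt)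
    (fun p hp q hq h => injOn_sph R hp hq (WithLp.ofLp_injective 2 h))]
  refine setIntegral_congr_fun (measurableSet_sphBox R) fun q hq => ?_
  rw [mem_sphBox] at hq
  have hs := Real.sin_pos_of_pos_of_lt_pi hq.2.1.1 hq.2.1.2
  simp only [hdet, smul_eq_mul, WithLp.toLp_ofLp]
  rw [abs_of_nonneg (by positivity), mul_comm]

/-! ### Stokes' theorem on the shells of the hypersurface. -/

section Shell

variable {M : Type*} [TopologicalSpace M] [ChartedSpace E4 M] [IsManifold 𝓘(ℝ, E4) ∞ M]
  {g : LorentzianMetric M} {vol : g.VolumeForm} {t φ : Field M} {H : Set M}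
  {c : AsymptoticChart g vol t φ} (N : HorizonToInfinity H c)

/-- The form `vol (X, ·, ·, ·)` pulls back to a top form on `ℝ³`, so the change of frame multiplies
it by the Jacobian, the same factor as in `integral_shell`. -/
lemma vol_sphParam (X : Field M) {q : Fin 3 → ℝ} (hq : 1 ≤ q 0) :
    vol.toFun (N.sphParam q) ![X (N.sphParam q),
        mfderiv 𝓘(ℝ, Fin 3 → ℝ) 𝓘(ℝ, E4) N.sphParam q (Pi.single 0 1),
        mfderiv 𝓘(ℝ, Fin 3 → ℝ) 𝓘(ℝ, E4) N.sphParam q (Pi.single 1 1),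
        mfderiv 𝓘(ℝ, Fin 3 → ℝ) 𝓘(ℝ, E4) N.sphParam q (Pi.single 2 1)] =
      N.fluxDensity X (sph q) * (q 0 ^ 2 * Real.sin (q 1)) := by
  rw [mfderiv_sphParam N hq, mfderiv_sphParam N hq, mfderiv_sphParam N hq]
  let A : E3 [⋀^Fin 3]→ₗ[ℝ] ℝ :=
    ((vol.toFun (N.param (sph q))).curryLeft (X (N.param (sph q)))).compLinearMap
      (mfderiv 𝓘(ℝ, E3) 𝓘(ℝ, E4) N.param (sph q)).toLinearMap
  have hA (v : Fin 3 → E3) : A v = vol.toFun (N.param (sph q)) ![X (N.param (sph q)),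
      mfderiv 𝓘(ℝ, E3) 𝓘(ℝ, E4) N.param (sph q) (v 0),
      mfderiv 𝓘(ℝ, E3) 𝓘(ℝ, E4) N.param (sph q) (v 1),
      mfderiv 𝓘(ℝ, E3) 𝓘(ℝ, E4) N.param (sph q) (v 2)] := by
    change vol.toFun (N.param (sph q)) _ = _
    congr 1
    funext i
    fin_cases i <;> rfl
  have h := DFunLike.congr_fun (A.eq_smul_basis_det (EuclideanSpace.basisFun (Fin 3) ℝ).toBasis)
    (fun j => fderiv ℝ sph q (Pi.single j 1))
  rw [AlternatingMap.smul_apply, hA, hA, smul_eq_mul] at h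
  refine h.trans (congrArg₂ _ ?_ ?_)
  · simp only [HorizonToInfinity.fluxDensity, OrthonormalBasis.coe_toBasis,
      EuclideanSpace.basisFun_apply, basisVec3]
  · rw [Module.Basis.det_apply, Matrix.det_fin_three]
    simp only [Module.Basis.toMatrix_apply, fderiv_sph]
    simp
    have h1 := Real.sin_sq_add_cos_sq (q 1)
    have h2 := Real.sin_sq_add_cos_sq (q 2)
    linear_combination (q 0 ^ 2 * Real.sin (q 1) *
      (Real.sin (q 1) ^ 2 + Real.cos (q 1) ^ 2)) * h2 + (q 0 ^ 2 * Real.sin (q 1)) * h1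

/-- The Stokes theorem on `{1 ≤ |y| ≤ R}`. -/
lemma integral_shell_eq {J X : Field M} (hJ : IsSmoothField 1 J)
    (hX : PreservesVolumeAndField vol J X) (hH : g.IsNullHypersurfaceGeneratedBy H X)
    (hXJ : ∀ p, g.toFun p (X p) (J p) = 0) {s : M → ℝ} (hs : ∀ p, g.divergence J p = - s p)
    {R : ℝ} (hR : 1 ≤ R) :
    ∫ y in shell R, s (N.param y) * N.fluxDensity X y =
      ∫ x in Set.Icc (![0, 0] : Fin 2 → ℝ) ![Real.pi, 2 * Real.pi],
        pulledFlux vol J X N.sphParam 0 ![R, x 0, x 1] := by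
  rw [integral_shell, ← integral_box N hJ hX hH hXJ hs hR]
  refine setIntegral_congr_fun measurableSet_Icc fun q hq => ?_
  exact (mul_assoc _ _ _).trans (congrArg _ (vol_sphParam N X (hq.1 0)).symm)

end Shell

/-! ### Spherical coordinates on the asymptotic region. -/

lemma contDiff_sphericalMap {n : WithTop ℕ∞} : ContDiff ℝ n sphericalMap := by
  rw [contDiff_piLp]
  intro i
  fin_cases i <;> simp [sphericalMap] <;> fun_prop

lemma fderiv_sphericalMap (q v : E4) : fderiv ℝ sphericalMap q v =
    !₂[v 0, v 1 * Real.sin (q 2) * Real.cos (q 3) + q 1 * Real.cos (q 2) * v 2 * Real.cos (q 3)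
        - q 1 * Real.sin (q 2) * Real.sin (q 3) * v 3,
      v 1 * Real.sin (q 2) * Real.sin (q 3) + q 1 * Real.cos (q 2) * v 2 * Real.sin (q 3)
        + q 1 * Real.sin (q 2) * Real.cos (q 3) * v 3,
      v 1 * Real.cos (q 2) - q 1 * Real.sin (q 2) * v 2] := by
  have hd : HasFDerivAt sphericalMap (fderiv ℝ sphericalMap q) q :=
    ((contDiff_sphericalMap (n := 1)).differentiable (by simp) q).hasFDerivAt
  have hp (i : Fin 4) : HasFDerivAt (fun z => sphericalMap z i)
      ((EuclideanSpace.proj i : E4 →L[ℝ] ℝ).comp (fderiv ℝ sphericalMap q)) q :=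
    ((EuclideanSpace.proj i : E4 →L[ℝ] ℝ).hasFDerivAt).comp q hd
  have h (i : Fin 4) : HasFDerivAt (fun z : E4 => z i) (EuclideanSpace.proj i : E4 →L[ℝ] ℝ) q :=
    (EuclideanSpace.proj i : E4 →L[ℝ] ℝ).hasFDerivAt
  ext i
  fin_cases i
  · exact DFunLike.congr_fun ((hp 0).unique (h 0)) v
  · have := DFunLike.congr_fun ((hp 1).unique (((h 1).mul (h 2).sin).mul (h 3).cos)) v
    refine this.trans ?_
    simp
    ring
  · have := DFunLike.congr_fun ((hp 2).unique (((h 1).mul (h 2).sin).mul (h 3).sin)) v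
    refine this.trans ?_
    simp
    ring
  · have := DFunLike.congr_fun ((hp 3).unique ((h 1).mul (h 2).cos)) v
    refine this.trans ?_
    simp
    ring

lemma norm_spatial_sphericalMap (q : E4) : ‖spatial (sphericalMap q)‖ = |q 1| := by
  have h := norm_sph ![q 1, q 2, q 3]
  simpa [sph, spatial, sphericalMap] using h

lemma fderiv_norm_spatial {x : E4} (hx : 0 < ‖spatial x‖) (v : E4) :
    fderiv ℝ (fun x : E4 => ‖spatial x‖) x v =
      (x 1 * v 1 + x 2 * v 2 + x 3 * v 3) / ‖spatial x‖ := by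
  have hn (z : E4) : ‖spatial z‖ = √(z 1 ^ 2 + z 2 ^ 2 + z 3 ^ 2) := by
    rw [← Real.sqrt_sq (norm_nonneg _), norm_sq_E3]
    rfl
  have h (i : Fin 4) : HasFDerivAt (fun z : E4 => z i) (EuclideanSpace.proj i : E4 →L[ℝ] ℝ) x :=
    (EuclideanSpace.proj i : E4 →L[ℝ] ℝ).hasFDerivAt
  have hpos : x 1 ^ 2 + x 2 ^ 2 + x 3 ^ 2 ≠ 0 := by
    intro h0
    rw [hn, h0] at hx
    simp at hx
  have hd := (((((h 1).pow 2).add ((h 2).pow 2)).add ((h 3).pow 2)).sqrt hpos)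
  have he : (fun x : E4 => ‖spatial x‖) = fun z => √(z 1 ^ 2 + z 2 ^ 2 + z 3 ^ 2) := funext hn
  have := DFunLike.congr_fun hd.fderiv v
  rw [he]
  refine this.trans ?_
  simp only [hn]
  simp
  field_simp

/-! ### Invariance of the radial flux density under `t` and `φ`. -/

section Asymptotics

variable {M : Type*} [TopologicalSpace M] [ChartedSpace E4 M] [IsManifold 𝓘(ℝ, E4) ∞ M]
  {g : LorentzianMetric M} {vol : g.VolumeForm} {t φ : Field M}
  (c : AsymptoticChart g vol t φ)

/-- The density `√(-g) r J^r` with respect to the coordinates `(t, x, y, z)`. -/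
def radialDensity (J : Field M) (x : E4) : ℝ :=
  volDensity vol c.chart x * (x 1 * fieldComp c.chart J x 1 + x 2 * fieldComp c.chart J x 2
    + x 3 * fieldComp c.chart J x 3)

/-- The metric matrix transforms to `P G Pᵀ` with `det P = r² sin θ`. Orientation and `sin θ ≥ 0`
make the product on the right nonnegative, hence the square root. -/
lemma sqrtNegDet_eq {q : E4} (hq : sphericalMap q ∈ c.chart.target) (hs : 0 ≤ Real.sin (q 2)) :
    c.sqrtNegDet q = q 1 ^ 2 * Real.sin (q 2) * volDensity vol c.chart (sphericalMap q) := by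
  let P : Matrix (Fin 4) (Fin 4) ℝ :=
    Matrix.of fun a μ => fderiv ℝ sphericalMap q (basisVec a) μ
  have hP : P.det = q 1 ^ 2 * Real.sin (q 2) := by
    have h : P.det = det4 (fderiv ℝ sphericalMap q (basisVec 0))
        (fderiv ℝ sphericalMap q (basisVec 1)) (fderiv ℝ sphericalMap q (basisVec 2))
        (fderiv ℝ sphericalMap q (basisVec 3)) := by
      unfold det4
      congr 1
      ext i j
      fin_cases i <;> rfl
    rw [h, det4_expand]
    simp only [fderiv_sphericalMap, basisVec]
    simp
    have h1 := Real.sin_sq_add_cos_sq (q 2)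
    have h2 := Real.sin_sq_add_cos_sq (q 3)
    linear_combination (q 1 ^ 2 * Real.sin (q 2) *
      (Real.sin (q 2) ^ 2 + Real.cos (q 2) ^ 2)) * h2 + (q 1 ^ 2 * Real.sin (q 2)) * h1
  have hm : Matrix.of (c.sphericalComp q) =
      P * (Matrix.of fun μ ν => g.comp c.chart μ ν (sphericalMap q)) * P.transpose := by
    ext a b
    simp only [Matrix.of_apply, AsymptoticChart.sphericalComp, Matrix.mul_apply,
      Matrix.transpose_apply, P, Finset.sum_mul]
    rw [Finset.sum_comm]
    exact Finset.sum_congr rfl fun ν _ => Finset.sum_congr rfl fun μ _ => by ring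
  have hD : 0 < volDensity vol c.chart (sphericalMap q) := c.oriented _ hq
  have hsq := volDensity_sq (e := c.chart) vol (sphericalMap q)
  rw [AsymptoticChart.sqrtNegDet, hm, Matrix.det_mul, Matrix.det_mul, Matrix.det_transpose, hP,
    show -(q 1 ^ 2 * Real.sin (q 2) *
      (Matrix.of fun μ ν => g.comp c.chart μ ν (sphericalMap q)).det *
      (q 1 ^ 2 * Real.sin (q 2))) =
      (q 1 ^ 2 * Real.sin (q 2) * volDensity vol c.chart (sphericalMap q)) ^ 2 by
      linear_combination -(q 1 ^ 2 * Real.sin (q 2)) ^ 2 * hsq]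
  exact Real.sqrt_sq (by positivity)

lemma radialComp_mul_sqrtNegDet (J : Field M) {q : E4} (hq : c.R₀ < q 1)
    (hs : 0 ≤ Real.sin (q 2)) : c.radialComp J q * c.sqrtNegDet q =
      q 1 * Real.sin (q 2) * radialDensity c J (sphericalMap q) := by
  have h0 : 0 < q 1 := c.R₀_pos.trans hq
  have hn : ‖spatial (sphericalMap q)‖ = q 1 := by
    rw [norm_spatial_sphericalMap, abs_of_pos h0]
  have ht : sphericalMap q ∈ c.chart.target := by
    rw [c.target_eq]
    change c.R₀ < ‖spatial (sphericalMap q)‖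
    rwa [hn]
  rw [sqrtNegDet_eq c ht hs, AsymptoticChart.radialComp,
    fderiv_norm_spatial (by rw [hn]; exact h0), hn, radialDensity]
  field_simp

variable {J : Field M}

/-- Invariance of the radial density under a symmetry that is an infinitesimal affine map in the
asymptotic chart and preserves the Euclidean inner product of the spatial parts. -/
lemma fderiv_radialDensity {V : Field M} (hV : PreservesVolumeAndField vol J V) (b : E4)
    (hJ : IsSmoothField 1 J)
    (L : E4 →L[ℝ] E4) (hL : ∀ z ∈ c.chart.target, fieldComp c.chart V z = b + L z)
    (htr : tr4 L = 0) {x : E4} (hx : x ∈ c.chart.target)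
    (hskew : ∀ w : E4, (b + L x) 1 * w 1 + (b + L x) 2 * w 2 + (b + L x) 3 * w 3
      + (x 1 * L w 1 + x 2 * L w 2 + x 3 * L w 3) = 0) :
    fderiv ℝ (radialDensity c J) x (b + L x) = 0 := by
  have hd : fderiv ℝ (fieldComp c.chart V) x = L := by
    have : fieldComp c.chart V =ᶠ[𝓝 x] fun z => b + L z := by
      filter_upwards [c.chart.open_target.mem_nhds hx] with z hz using hL z hz
    rw [this.fderiv_eq]
    exact (L.hasFDerivAt.const_add b).fderiv
  have he := c.mem_maximalAtlas
  have hcomm := hV.comm _ he x hx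
  have hdens := hV.density _ he x hx
  rw [hd, hL x hx] at hcomm hdens
  rw [htr, mul_zero, add_zero] at hdens
  have hD := ((contDiffAt_volDensity vol he hx).differentiableAt (by simp)).hasFDerivAt
  have hJd := ((contDiffAt_fieldComp he hJ hx).differentiableAt (by simp)).hasFDerivAt
  have hp (i : Fin 4) : HasFDerivAt (fun z => fieldComp c.chart J z i)
      ((EuclideanSpace.proj i : E4 →L[ℝ] ℝ).comp (fderiv ℝ (fieldComp c.chart J) x)) x :=
    ((EuclideanSpace.proj i : E4 →L[ℝ] ℝ).hasFDerivAt).comp x hJd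
  have h (i : Fin 4) : HasFDerivAt (fun z : E4 => z i) (EuclideanSpace.proj i : E4 →L[ℝ] ℝ) x :=
    (EuclideanSpace.proj i : E4 →L[ℝ] ℝ).hasFDerivAt
  have hK := hD.mul ((((h 1).mul (hp 1)).add ((h 2).mul (hp 2))).add ((h 3).mul (hp 3)))
  have := DFunLike.congr_fun hK.fderiv (b + L x)
  refine this.trans ?_
  -- Since `J` commutes with `V`, the derivative of `J` along `V` is `L J`. The derivative of the
  -- spatial product `x · J` is then `V · J + x · L J`, which vanishes by skewness.
  have hs := hskew (fieldComp c.chart J x)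
  have hpr (i : Fin 4) (w : E4) : (EuclideanSpace.proj i : E4 →L[ℝ] ℝ) w = w i := rfl
  simp only [add_apply, smul_apply, ContinuousLinearMap.comp_apply, smul_eq_mul, hdens, hcomm, hpr, mul_zero, add_zero]
  linear_combination volDensity vol c.chart x * hs

lemma fderiv_radialDensity_time (hJ : IsSmoothField 1 J) (ht : PreservesVolumeAndField vol J t)
    {x : E4} (hx : x ∈ c.chart.target) :
    fderiv ℝ (radialDensity c J) x !₂[1, 0, 0, 0] = 0 := by
  have := fderiv_radialDensity c ht !₂[1, 0, 0, 0] hJ 0 (by simpa using c.time)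
    (by simp [tr4]) hx (by simp)
  simpa using this

/-- The rotation generator `x ∂_y - y ∂_x`. -/
def rotationMap : E4 →L[ℝ] E4 :=
  LinearMap.toContinuousLinearMap
    { toFun := fun x => !₂[0, -(x 2), x 1, 0]
      map_add' := fun x y => by
        ext i; fin_cases i <;> simp; ring
      map_smul' := fun r x => by
        ext i; fin_cases i <;> simp }

lemma rotationMap_apply (x : E4) : rotationMap x = !₂[0, -(x 2), x 1, 0] := rfl

lemma fderiv_radialDensity_rotation (hJ : IsSmoothField 1 J)
    (hφ : PreservesVolumeAndField vol J φ) {x : E4} (hx : x ∈ c.chart.target) :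
    fderiv ℝ (radialDensity c J) x !₂[0, -(x 2), x 1, 0] = 0 := by
  have := fderiv_radialDensity c hφ 0 hJ rotationMap
    (by simpa [rotationMap_apply] using c.rotation)
    (by simp [tr4, rotationMap_apply, basisVec, Fin.sum_univ_four]) hx
    (fun w => by simp [rotationMap_apply])
  simpa [rotationMap_apply] using this

lemma sphericalMap_mem_target {q : E4} (hq : c.R₀ < q 1) : sphericalMap q ∈ c.chart.target := by
  rw [c.target_eq]
  change c.R₀ < ‖spatial (sphericalMap q)‖
  rw [norm_spatial_sphericalMap]
  exact hq.trans_le (le_abs_self _)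

lemma differentiableAt_radialDensity (hJ : IsSmoothField 1 J) {x : E4} (hx : x ∈ c.chart.target) :
    DifferentiableAt ℝ (radialDensity c J) x := by
  have he := c.mem_maximalAtlas
  have hD := ((contDiffAt_volDensity vol he hx).differentiableAt (by simp))
  have hJd := ((contDiffAt_fieldComp he hJ hx).differentiableAt (by simp)).hasFDerivAt
  have hp (i : Fin 4) : DifferentiableAt ℝ (fun z => fieldComp c.chart J z i) x :=
    (((EuclideanSpace.proj i : E4 →L[ℝ] ℝ).hasFDerivAt).comp x hJd).differentiableAt
  have h (i : Fin 4) : DifferentiableAt ℝ (fun z : E4 => z i) x :=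
    (EuclideanSpace.proj i : E4 →L[ℝ] ℝ).differentiableAt
  exact hD.mul ((((h 1).mul (hp 1)).add ((h 2).mul (hp 2))).add ((h 3).mul (hp 3)))

/-- The radial density depends only on `r` and `θ`. -/
lemma radialDensity_sphericalMap (hJ : IsSmoothField 1 J) (ht : PreservesVolumeAndField vol J t)
    (hφ : PreservesVolumeAndField vol J φ) {r : ℝ} (hr : c.R₀ < r) (θ τ ϕ τ' ϕ' : ℝ) :
    radialDensity c J (sphericalMap !₂[τ, r, θ, ϕ]) =
      radialDensity c J (sphericalMap !₂[τ', r, θ, ϕ']) := by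
  have hmem (τ ϕ) : sphericalMap !₂[τ, r, θ, ϕ] ∈ c.chart.target :=
    sphericalMap_mem_target c (by simpa using hr)
  have hline (τ ϕ : ℝ) (v : E4) (γ : ℝ → E4) (s : ℝ) (hγ : HasDerivAt γ v s)
      (h : γ s = !₂[τ, r, θ, ϕ]) : HasDerivAt (fun s => radialDensity c J (sphericalMap (γ s)))
      (fderiv ℝ (radialDensity c J) (sphericalMap !₂[τ, r, θ, ϕ])
        (fderiv ℝ sphericalMap !₂[τ, r, θ, ϕ] v)) s := by
    have h1 := (differentiableAt_radialDensity c hJ (hmem τ ϕ)).hasFDerivAt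
    have h2 := ((contDiff_sphericalMap (n := 1)).differentiable (by simp)
      !₂[τ, r, θ, ϕ]).hasFDerivAt
    rw [← h] at h1 h2 ⊢
    exact h1.comp_hasDerivAt s (h2.comp_hasDerivAt s hγ)
  have hγ (i : Fin 4) (x : E4) (s : ℝ) :
      HasDerivAt (fun s : ℝ => x + s • basisVec i) (basisVec i) s := by
    simpa using ((hasDerivAt_id s).smul_const (basisVec i)).const_add x
  have hτ : radialDensity c J (sphericalMap !₂[τ, r, θ, ϕ]) =
      radialDensity c J (sphericalMap !₂[τ', r, θ, ϕ]) := by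
    have e (s : ℝ) : !₂[0, r, θ, ϕ] + s • basisVec 0 = !₂[s, r, θ, ϕ] := by
      ext i; fin_cases i <;> simp [basisVec]
    have hd (s : ℝ) := hline s ϕ _ _ s (hγ 0 !₂[0, r, θ, ϕ] s) (e s)
    have hz (s : ℝ) : fderiv ℝ sphericalMap !₂[s, r, θ, ϕ] (basisVec 0) = !₂[1, 0, 0, 0] := by
      rw [fderiv_sphericalMap]
      ext i; fin_cases i <;> simp [basisVec]
    simp only [hz, fderiv_radialDensity_time c hJ ht (hmem _ _), e] at hd
    exact is_const_of_deriv_eq_zero (fun s => (hd s).differentiableAt) (fun s => (hd s).deriv) τ τ'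
  have hϕ : radialDensity c J (sphericalMap !₂[τ', r, θ, ϕ]) =
      radialDensity c J (sphericalMap !₂[τ', r, θ, ϕ']) := by
    have e (s : ℝ) : !₂[τ', r, θ, 0] + s • basisVec 3 = !₂[τ', r, θ, s] := by
      ext i; fin_cases i <;> simp [basisVec]
    have hd (s : ℝ) := hline τ' s _ _ s (hγ 3 !₂[τ', r, θ, 0] s) (e s)
    have hz (s : ℝ) : fderiv ℝ sphericalMap !₂[τ', r, θ, s] (basisVec 3) =
        !₂[0, -(sphericalMap !₂[τ', r, θ, s] 2), sphericalMap !₂[τ', r, θ, s] 1, 0] := by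
      rw [fderiv_sphericalMap]
      ext i; fin_cases i <;> simp [basisVec, sphericalMap]
    simp only [hz, fderiv_radialDensity_rotation c hJ hφ (hmem _ _), e] at hd
    exact is_const_of_deriv_eq_zero (fun s => (hd s).differentiableAt) (fun s => (hd s).deriv) ϕ ϕ'
  exact hτ.trans hϕ

end Asymptotics

/-! ### The flux through large spheres and the limit. -/

section Limit

variable {M : Type*} [TopologicalSpace M] [ChartedSpace E4 M] [IsManifold 𝓘(ℝ, E4) ∞ M]
  {g : LorentzianMetric M} {vol : g.VolumeForm} {t φ : Field M} {H : Set M}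
  {c : AsymptoticChart g vol t φ} (N : HorizonToInfinity H c)

/-- The height function `t = h(r, θ, φ)` of the hypersurface in the asymptotic region. -/
def HorizonToInfinity.height (q : Fin 3 → ℝ) : ℝ := c.chart (N.sphParam q) 0

lemma sphParam_mem_source {q : Fin 3 → ℝ} (h1 : 1 < q 0) (hR : N.R₁ < q 0) :
    N.sphParam q ∈ c.chart.source :=
  (N.graph _ (sph_mem_exteriorDomain h1.le) (by rw [norm_sph]; exact hR.trans_le (le_abs_self _))).1

lemma chart_sphParam {q : Fin 3 → ℝ} (h1 : 1 < q 0) (hR : N.R₁ < q 0) :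
    c.chart (N.sphParam q) = sphericalMap !₂[N.height q, q 0, q 1, q 2] := by
  have h := (N.graph _ (sph_mem_exteriorDomain h1.le)
    (by rw [norm_sph]; exact hR.trans_le (le_abs_self _))).2
  have h' (i : Fin 3) : spatial (c.chart (N.sphParam q)) i = sph q i := congrArg (fun z : E3 => z i) h
  ext i
  fin_cases i
  · rfl
  · exact h' 0
  · exact h' 1
  · exact h' 2

/-- No relation between `R₁` and `R₀` is assumed; this one follows because the graph lies in the
domain of the chart. -/
lemma lt_of_R₁_lt {q : Fin 3 → ℝ} (h1 : 1 < q 0) (hR : N.R₁ < q 0) : c.R₀ < q 0 := by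
  have h := c.chart.map_source (sphParam_mem_source N h1 hR)
  rw [c.target_eq, chart_sphParam N h1 hR] at h
  change c.R₀ < ‖spatial _‖ at h
  rw [norm_spatial_sphericalMap] at h
  simpa [abs_of_pos (zero_lt_one.trans h1)] using h

lemma contDiffAt_height {q : Fin 3 → ℝ} (h1 : 1 < q 0) (hR : N.R₁ < q 0) :
    ContDiffAt ℝ 1 N.height q :=
  ((EuclideanSpace.proj 0 : E4 →L[ℝ] ℝ).contDiff.contDiffAt).comp q
    (contDiffAt_chart_comp (n := 1) c.mem_maximalAtlas (contMDiffAt_sphParam N h1.le)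
      (sphParam_mem_source N h1 hR))

lemma fderiv_chart_sphParam {q : Fin 3 → ℝ} (h1 : 1 < q 0) (hR : N.R₁ < q 0) (v : Fin 3 → ℝ) :
    fderiv ℝ (fun z => c.chart (N.sphParam z)) q v =
      !₂[fderiv ℝ N.height q v, fderiv ℝ sph q v 0, fderiv ℝ sph q v 1, fderiv ℝ sph q v 2] := by
  have hd := ((contDiffAt_chart_comp (n := 1) c.mem_maximalAtlas (contMDiffAt_sphParam N h1.le)
      (sphParam_mem_source N h1 hR)).differentiableAt (by simp)).hasFDerivAt
  have hp (i : Fin 4) := ((EuclideanSpace.proj i : E4 →L[ℝ] ℝ).hasFDerivAt).comp q hd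
  have hs := ((contDiff_sph (n := 1)).differentiable (by simp) q).hasFDerivAt
  have hps (i : Fin 3) := ((EuclideanSpace.proj i : E3 →L[ℝ] ℝ).hasFDerivAt).comp q hs
  have hev : ∀ᶠ z : Fin 3 → ℝ in 𝓝 q, 1 < z 0 ∧ N.R₁ < z 0 :=
    ((continuous_apply 0).continuousAt.eventually (lt_mem_nhds h1)).and
      ((continuous_apply 0).continuousAt.eventually (lt_mem_nhds hR))
  have hcoord (i : Fin 3) : (fun z => c.chart (N.sphParam z) i.succ) =ᶠ[𝓝 q] fun z => sph z i := by
    filter_upwards [hev] with z hz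
    rw [chart_sphParam N hz.1 hz.2]
    fin_cases i <;> rfl
  have hcomp (i : Fin 3) : (fderiv ℝ (fun z => c.chart (N.sphParam z)) q v) i.succ =
      fderiv ℝ sph q v i :=
    DFunLike.congr_fun ((hp i.succ).unique ((hps i).congr_of_eventuallyEq (hcoord i))) v
  ext i
  fin_cases i
  · exact (DFunLike.congr_fun (hp 0).fderiv v).symm
  · exact hcomp 0
  · exact hcomp 1
  · exact hcomp 2

variable {J X : Field M} {Ω : ℝ}

lemma fieldComp_chart (hX : ∀ p, X p = t p + Ω • φ p) {x : E4} (hx : x ∈ c.chart.target) :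
    fieldComp c.chart X x = !₂[1, -(Ω * x 2), Ω * x 1, 0] := by
  rw [fieldComp_add_smul c.chart hX]
  beta_reduce
  rw [c.time x hx, c.rotation x hx]
  ext i
  fin_cases i <;> simp

/-- The tangent vectors of the sphere are `∂_θ + h_θ ∂_t` and `∂_φ + h_φ ∂_t`, and `X = ∂_t + Ω
∂_φ`. None has an `r` component, so only `J^r` enters, with cofactor `-(1 - Ω h_φ)`; the sign comes
from the order `(r, t, θ, φ)`. -/
lemma pulledFlux_asymptotic (hX : ∀ p, X p = t p + Ω • φ p) {q : Fin 3 → ℝ} (h1 : 1 < q 0)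
    (hR : N.R₁ < q 0) : pulledFlux vol J X N.sphParam 0 q =
      -((1 - Ω * fderiv ℝ N.height q (Pi.single 2 1)) * (q 0 * Real.sin (q 1) *
        radialDensity c J (sphericalMap !₂[N.height q, q 0, q 1, q 2]))) := by
  have hsrc := sphParam_mem_source N h1 hR
  have hpull := vol_pullback_two (vol := vol) c.mem_maximalAtlas
    ((contMDiffAt_sphParam N h1.le).mdifferentiableAt (by simp)) hsrc J X (Pi.single 1 1)
    (Pi.single 2 1)
  refine hpull.trans ?_
  rw [fieldComp_chart hX (c.chart.map_source hsrc), fderiv_chart_sphParam N h1 hR,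
    fderiv_chart_sphParam N h1 hR, chart_sphParam N h1 hR, radialDensity, det4_expand]
  simp only [fderiv_sph, sphericalMap]
  simp
  generalize fieldComp c.chart J _ = w
  generalize volDensity vol c.chart _ = D
  have e2 := Real.sin_sq_add_cos_sq (q 2)
  generalize fderiv ℝ N.height q (Pi.single 2 1) = h2
  linear_combination (-D * (1 - Ω * h2) * q 0 ^ 2 * Real.sin (q 1) * Real.cos (q 1) * w 3) * e2

lemma continuous_pulledFlux_sphere (hJ : IsSmoothField 1 J) (hX : PreservesVolumeAndField vol J X)
    {R : ℝ} (hR : 1 ≤ R) (i : Fin 3) :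
    Continuous fun x : ℝ × ℝ => pulledFlux vol J X N.sphParam i ![R, x.1, x.2] := by
  rw [continuous_iff_continuousAt]
  intro x
  refine ContinuousAt.comp (f := fun x : ℝ × ℝ => ![R, x.1, x.2])
    (contDiffAt_pulledFlux hJ hX (contMDiffAt_sphParam N (by simpa using hR)) i).continuousAt ?_
  refine Continuous.continuousAt (continuous_pi fun i => ?_)
  fin_cases i
  · exact continuous_const
  · exact continuous_fst
  · exact continuous_snd

lemma setIntegral_Icc_fin_two {F : ℝ × ℝ → ℝ} (hF : Continuous F) {a b : ℝ} (ha : 0 ≤ a)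
    (hb : 0 ≤ b) : ∫ x in Set.Icc (![0, 0] : Fin 2 → ℝ) ![a, b], F (x 0, x 1) =
      ∫ θ in (0 : ℝ)..a, ∫ ϕ in (0 : ℝ)..b, F (θ, ϕ) := by
  have hmp := volume_preserving_finTwoArrow ℝ
  have h := hmp.setIntegral_preimage_emb MeasurableEquiv.finTwoArrow.measurableEmbedding F
    (Set.Icc 0 a ×ˢ Set.Icc 0 b)
  have hset : (MeasurableEquiv.finTwoArrow (α := ℝ)) ⁻¹' (Set.Icc 0 a ×ˢ Set.Icc 0 b) =
      Set.Icc (![0, 0] : Fin 2 → ℝ) ![a, b] := by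
    ext x
    simp [MeasurableEquiv.finTwoArrow, Pi.le_def, Fin.forall_fin_two]
  rw [hset] at h
  refine h.trans ?_
  rw [Measure.volume_eq_prod, setIntegral_prod F
    (hF.continuousOn.integrableOn_compact (isCompact_Icc.prod isCompact_Icc)),
    intervalIntegral.integral_of_le ha, integral_Icc_eq_integral_Ioc]
  simp only [intervalIntegral.integral_of_le hb, integral_Icc_eq_integral_Ioc]

/-- The flux through a large sphere of the hypersurface is the flux through the sphere of the same
radius at fixed time: the density is invariant under both Killing flows, and the tilt of the
hypersurface along the rotation integrates to zero. -/
lemma integral_pulledFlux_eq (hJ : IsSmoothField 1 J) (ht : PreservesVolumeAndField vol J t)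
    (hφ : PreservesVolumeAndField vol J φ) (hX : ∀ p, X p = t p + Ω • φ p) {R : ℝ} (h1 : 1 < R)
    (hR : N.R₁ < R) (t₀ : ℝ) :
    ∫ x in Set.Icc (![0, 0] : Fin 2 → ℝ) ![Real.pi, 2 * Real.pi],
      pulledFlux vol J X N.sphParam 0 ![R, x 0, x 1] = - c.sphereFlux J t₀ R := by
  have hR0 : c.R₀ < R := lt_of_R₁_lt N (q := ![R, 0, 0]) h1 hR
  refine (setIntegral_Icc_fin_two
    (continuous_pulledFlux_sphere N hJ (ht.add_smul hφ hX) h1.le 0) Real.pi_pos.le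
    Real.two_pi_pos.le).trans ?_
  rw [AsymptoticChart.sphereFlux, ← intervalIntegral.integral_neg]
  refine intervalIntegral.integral_congr fun θ hθ => ?_
  rw [Set.uIcc_of_le Real.pi_pos.le] at hθ
  have hs : 0 ≤ Real.sin θ := Real.sin_nonneg_of_nonneg_of_le_pi hθ.1 hθ.2
  -- By invariance, `A` is the value of `J^r √(-g)` on the whole circle of fixed `R` and `θ`, at
  -- every time; in particular on the tilted circle in the hypersurface.
  set A := R * Real.sin θ * radialDensity c J (sphericalMap !₂[t₀, R, θ, 0]) with hA
  have hrhs (ϕ : ℝ) : c.radialComp J !₂[t₀, R, θ, ϕ] * c.sqrtNegDet !₂[t₀, R, θ, ϕ] = A := by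
    rw [radialComp_mul_sqrtNegDet c J (by simpa using hR0) (by simpa using hs), hA,
      radialDensity_sphericalMap c hJ ht hφ hR0 θ t₀ ϕ t₀ 0]
    simp
  have hlhs (ϕ : ℝ) : pulledFlux vol J X N.sphParam 0 ![R, θ, ϕ] =
      Ω * fderiv ℝ N.height ![R, θ, ϕ] (Pi.single 2 1) * A - A := by
    rw [pulledFlux_asymptotic N hX (by simpa using h1) (by simpa using hR), hA]
    have := radialDensity_sphericalMap c hJ ht hφ hR0 θ (N.height ![R, θ, ϕ]) ϕ t₀ 0
    simp only [Matrix.cons_val_zero, Matrix.cons_val_one, Matrix.cons_val]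
    rw [this]
    ring
  have hγ (ϕ : ℝ) : HasDerivAt (fun ϕ : ℝ => (![R, θ, ϕ] : Fin 3 → ℝ)) (Pi.single 2 1) ϕ := by
    refine hasDerivAt_pi.2 fun i => ?_
    fin_cases i
    · exact hasDerivAt_const _ _
    · exact hasDerivAt_const _ _
    · exact hasDerivAt_id _
  have hheight (ϕ : ℝ) : ContDiffAt ℝ 1 N.height ![R, θ, ϕ] :=
    contDiffAt_height N (by simpa using h1) (by simpa using hR)
  have hder (ϕ : ℝ) : HasDerivAt (fun ϕ => N.height ![R, θ, ϕ])
      (fderiv ℝ N.height ![R, θ, ϕ] (Pi.single 2 1)) ϕ :=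
    HasFDerivAt.comp_hasDerivAt (f := fun ϕ : ℝ => (![R, θ, ϕ] : Fin 3 → ℝ)) ϕ
      ((hheight ϕ).differentiableAt (by simp)).hasFDerivAt (hγ ϕ)
  have hcont : Continuous fun ϕ : ℝ => fderiv ℝ N.height ![R, θ, ϕ] (Pi.single 2 1) := by
    rw [continuous_iff_continuousAt]
    intro ϕ
    have h := ((hheight ϕ).fderiv_right (m := 0) (by simp)).continuousAt
    exact (ContinuousAt.comp (f := fun ϕ : ℝ => (![R, θ, ϕ] : Fin 3 → ℝ)) h
      (hγ ϕ).continuousAt).clm_apply continuousAt_const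
  -- The height is a function on the sphere, hence `2π`-periodic in the azimuth, and the integral of
  -- its derivative telescopes.
  have hint : ∫ ϕ in (0 : ℝ)..(2 * Real.pi), fderiv ℝ N.height ![R, θ, ϕ] (Pi.single 2 1) = 0 := by
    rw [intervalIntegral.integral_eq_sub_of_hasDerivAt (fun ϕ _ => hder ϕ)
      (hcont.intervalIntegrable _ _), sub_eq_zero]
    simp [HorizonToInfinity.height, HorizonToInfinity.sphParam, sph]
  simp only [hrhs, hlhs]
  have hcont' : Continuous fun ϕ : ℝ =>
      Ω * fderiv ℝ N.height ![R, θ, ϕ] (Pi.single 2 1) * A :=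
    (continuous_const.mul hcont).mul continuous_const
  rw [intervalIntegral.integral_sub (hcont'.intervalIntegrable _ _) (continuous_const.intervalIntegrable _ _),
    intervalIntegral.integral_mul_const, intervalIntegral.integral_const_mul, hint]
  simp

/-- The shells increase to the exterior domain, so absolute integrability yields convergence. -/
lemma tendsto_integral_shell {F : E3 → ℝ} (hF : IntegrableOn F exteriorDomain) :
    Tendsto (fun R : ℝ => ∫ y in shell R, F y) atTop (𝓝 (∫ y in exteriorDomain, F y)) := by
  have hU : ⋃ R : ℝ, shell R = exteriorDomain := by
    ext y
    simp only [Set.mem_iUnion]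
    exact ⟨fun ⟨_, h⟩ => h.1, fun h => ⟨‖y‖, h, le_rfl⟩⟩
  have h := tendsto_setIntegral_of_monotone (μ := volume) (f := F) measurableSet_shell
    (fun R R' hRR' y hy => ⟨hy.1, hy.2.trans hRR'⟩) (by rwa [hU])
  rwa [hU] at h

end Limit

end KillingFlux

end
theorem lemma1 {M : Type*} [TopologicalSpace M] [T2Space M] [ChartedSpace KillingFlux.E4 M]
    [IsManifold 𝓘(ℝ, KillingFlux.E4) ∞ M]
    (g : KillingFlux.LorentzianMetric M) (vol : g.VolumeForm)
    (t φ : KillingFlux.Field M)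
    (ht : KillingFlux.IsSmoothField ∞ t) (hφ : KillingFlux.IsSmoothField ∞ φ)
    (htK : g.IsKilling t) (hφK : g.IsKilling φ)
    (c : KillingFlux.AsymptoticChart g vol t φ)
    (Ω : ℝ) (X : KillingFlux.Field M) (hX : ∀ p, X p = t p + Ω • φ p)
    (H : Set M) (hH : g.IsNullHypersurfaceGeneratedBy H X)
    (J : KillingFlux.Field M) (hJ : KillingFlux.IsSmoothField 1 J)
    (S : M → ℝ) (ε : ℝ)
    (hdiv : ∀ p, g.divergence J p + ε * S p = 0)
    (htJ : ∀ p, VectorField.mlieBracket 𝓘(ℝ, KillingFlux.E4) t J p = 0)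
    (hφJ : ∀ p, VectorField.mlieBracket 𝓘(ℝ, KillingFlux.E4) φ J p = 0)
    (htJ0 : ∀ p, g.toFun p (t p) (J p) = 0)
    (hφJ0 : ∀ p, g.toFun p (φ p) (J p) = 0)
    (N : KillingFlux.HorizonToInfinity H c)
    (hint : N.FluxIntegrable S X) (t₀ : ℝ) :
    Tendsto (fun r => -c.sphereFlux J t₀ r) atTop (𝓝 (ε * N.fluxIntegral S X)) := by
  have ht' := KillingFlux.PreservesVolumeAndField.of_isKilling (vol := vol) hJ
    (ht.of_le (by simp)) htK htJ
  have hφ' := KillingFlux.PreservesVolumeAndField.of_isKilling (vol := vol) hJ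
    (hφ.of_le (by simp)) hφK hφJ
  have hXJ (p) : g.toFun p (X p) (J p) = 0 := by
    rw [hX, map_add, map_smul, LinearMap.add_apply, LinearMap.smul_apply, htJ0, hφJ0, smul_zero,
      add_zero]
  refine ((KillingFlux.tendsto_integral_shell hint).const_mul ε).congr' ?_
  -- For each such `R` the identity between the shell integral and the sphere flux is exact; the
  -- limit acts only on the shell integral.
  filter_upwards [eventually_gt_atTop 1, eventually_gt_atTop N.R₁] with R h1 hR
  rw [← KillingFlux.integral_pulledFlux_eq N hJ ht' hφ' hX h1 hR t₀,
    ← KillingFlux.integral_shell_eq N hJ (ht'.add_smul hφ' hX) hH hXJ (s := fun p => ε * S p)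
      (fun p => eq_neg_of_add_eq_zero_left (hdiv p)) h1.le, ← integral_const_mul]
  simp only [mul_assoc]
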